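/- All graphs are finite, simple and undirected, "contains" means "contains as an induced subgraph", and a path in a graph is always chordless (induced). **Layered wheels.** Let $l\ge 1$ and $k\ge 4$ be integers. An $(l,k)$-ehf-layered-wheel is a graph $G$ whose vertex set is partitioned into $l+1$ induced paths $P_0,P_1,\dots,P_l$ (the layers), each oriented from left to right, such that the conditions below hold. For a vertex $u\in P_i$, the ancestors of $u$ are its neighbours in $P_0\cup\dots\cup P_{i-1}$, and the type of $u$ is the number of its ancestors. * $P_0$ consists of a single vertex $r$. Exactly three vertices of $P_1$, among them both ends of $P_1$, are adjacent to $r$. * For $2\le i\le l$, the vertices of $P_i$ that have ancestors lie in pairwise disjoint subpaths of $P_i$, called zones, and both ends of $P_i$ have ancestors. A zone labelled $E_u$ (respectively $O_u$) contains exactly four (respectively three) vertices that have ancestors, and each of them has $u$ as its only ancestor; a zone labelled $E_{u,v}$ (respectively $O_{u,v}$) contains exactly four (respectively three) vertices that have ancestors, and the ancestors of each of them are exactly $u$ and $v$. The ends of a zone have ancestors. * For $2\le i\le l$, the zones of $P_i$ are obtained as follows. Each $u\in P_{i-1}$ has a box, a subpath of $P_i$ going through the following zones from left to right: first $E_{u',u}$,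 if $u$ has a left neighbour $u'$ in $P_{i-1}$; then the own zones of $u$; then $E_{u,u''}$, if $u$ has a right neighbour $u''$ in $P_{i-1}$. The own zones of $u$ are - $O_u$, if $u$ has type $0$; - $O_u,\ O_{u,v},\ O_u$, if $u$ has type $1$ with ancestor $v$; - $E_u,\ E_{v,w},\ O_u,\ O_{u,v},\ O_u,\ O_{u,w},\ O_u,\ E_{v,w},\ E_u$, if $u$ has type $2$ with ancestors $v\in P_a$ and $w\in P_b$, $b\le a$, where $v$ is to the left of $w$ if $a=b$. (No other types occur.) The boxes of consecutive vertices $u,u''$ of $P_{i-1}$ share exactly the zone $E_{u,u''}$; the path $P_i$ visits the boxes in the order of the vertices of $P_{i-1}$, and there are no other zones. * For $1\le i\le l$, let $x,y$ be two vertices of $P_i$ that have ancestors, such that all interior vertices of the subpath $xP_iy$ have type $0$. Then $xP_iy$ has length at least $k-2$; its length is odd if $x$ and $y$ have a common ancestor, and even otherwise. * There are no vertices or edges other than those specified. **Pyramids.** A pyramid is a graph made of three chordless paths $a\dots b_1$, $a\dots b_2$, $a\dots b_3$ of length at least one, at least two of which have length at least two, vertex-disjoint except at $a$, such that $b_1b_2b_3$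 is a triangle and there are no edges between the paths except those of the triangle and the three edges incident to $a$. A graph is pyramid-free if it contains no pyramid as an induced subgraph. **Theorem.** For all integers $l\ge 1$ and $k\ge 4$, every $(l,k)$-ehf-layered-wheel is pyramid-free. -/

import Mathlib

namespace EHFWheel

/-- A zone of a layer: a subpath containing exactly four (`even A`) or exactly three (`odd A`)
vertices that have ancestors, its two ends among them; each of these vertices has ancestor
list `A`. So `E_u`, `E_{u,v}`, `O_u`, `O_{u,v}` are `even [u]`, `even [u, v]`, `odd [u]`,
`odd [u, v]`. -/
inductive Zone (V : Type*) where
  | even (A : List V)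
  | odd (A : List V)

/-- The ancestor lists of the vertices with ancestors in a zone, from left to right. -/
def Zone.labels {V : Type*} : Zone V → List (List V)
  | .even A => List.replicate 4 A
  | .odd A => List.replicate 3 A

/-- The ancestors of a vertex `u` of layer `i`: its neighbours in layers `0, …, i - 1`.
They are listed with the higher layers first and, within a layer, from left to right. The number
of ancestors, i.e. the length of this list, is the type of `u`. -/
noncomputable def ancestors {V : Type*} (G : SimpleGraph V) (P : ℕ → List V) (i : ℕ) (u : V) :
    List V :=
  open Classical in ((List.range i).reverse.flatMap P).filter (fun x => G.Adj u x)

/-- The zones of the box of `u` that are not shared with the box of a neighbour of `u` in its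
layer, from left to right; the second argument is the list of ancestors of `u`. -/
def ownZones {V : Type*} (u : V) : List V → List (Zone V)
  | [] => [.odd [u]]
  | [v] => [.odd [u], .odd [u, v], .odd [u]]
  | [v, w] => [.even [u], .even [v, w], .odd [u], .odd [u, v], .odd [u], .odd [u, w], .odd [u],
      .even [v, w], .even [u]]
  -- more than two ancestors never occur
  | _ => []

/-- The zones of the next layer, from left to right, above a layer (given as a list).
The box of `u` consists of the zone `E_{u',u}` shared with the left neighbour `u'` of `u` (if there
is one), the own zones of `u`, and the zone `E_{u,u''}` shared with the right neighbour `u''`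
of `u` (if there is one). -/
def layerZones {V : Type*} (anc : V → List V) : List V → List (Zone V)
  | [] => []
  | [u] => ownZones u (anc u)
  | u :: u'' :: rest => ownZones u (anc u) ++ [.even [u, u'']] ++ layerZones anc (u'' :: rest)

/-- The lists `P 0, …, P l`, read from left to right, are the layers of an `(l, k)`-ehf-layered-wheel
structure on the graph `G`. -/
structure IsLayering {V : Type*} (l k : ℕ) (G : SimpleGraph V) (P : ℕ → List V) : Prop where
  /-- The layers partition the vertex set. -/
  cover : ∀ x : V, ∃ i ≤ l, x ∈ P i
  nodup : ∀ i ≤ l, (P i).Nodup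
  disjoint : ∀ i ≤ l, ∀ j ≤ l, i ≠ j → List.Disjoint (P i) (P j)
  /-- Each layer is a chordless path. -/
  path : ∀ i ≤ l, ∀ (a b : ℕ) (ha : a < (P i).length) (hb : b < (P i).length),
    G.Adj (P i)[a] (P i)[b] ↔ a + 1 = b ∨ b + 1 = a
  /-- Layer `0` is a single vertex. -/
  root : ∃ r : V, P 0 = [r]
  /-- The vertices of layer `i + 1` that have ancestors are, from left to right, those of the
  zones prescribed by layer `i`. This also describes all edges between different layers.
  For `i = 0` it says that exactly three vertices of layer `1` have an ancestor, namely `r`. -/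
  zones : ∀ i < l,
    ((P (i + 1)).map (ancestors G P (i + 1))).filter (fun A => !A.isEmpty) =
      (layerZones (ancestors G P i) (P i)).flatMap Zone.labels
  /-- The ends of the layers `1, …, l` have ancestors. -/
  left_end : ∀ i < l, ∀ u ∈ (P (i + 1)).head?, ancestors G P (i + 1) u ≠ []
  right_end : ∀ i < l, ∀ u ∈ (P (i + 1)).getLast?, ancestors G P (i + 1) u ≠ []
  /-- Lengths of the subpaths between two consecutive vertices that have ancestors. -/
  lengths : ∀ i < l, ∀ (a b : ℕ) (hab : a < b) (hb : b < (P (i + 1)).length),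
    ancestors G P (i + 1) (P (i + 1))[a] ≠ [] →
    ancestors G P (i + 1) (P (i + 1))[b] ≠ [] →
    (∀ (c : ℕ) (_ : a < c) (hcb : c < b), ancestors G P (i + 1) (P (i + 1))[c] = []) →
      k - 2 ≤ b - a ∧
      ((∃ x, x ∈ ancestors G P (i + 1) (P (i + 1))[a] ∧
          x ∈ ancestors G P (i + 1) (P (i + 1))[b]) → Odd (b - a)) ∧
      ((¬ ∃ x, x ∈ ancestors G P (i + 1) (P (i + 1))[a] ∧
          x ∈ ancestors G P (i + 1) (P (i + 1))[b]) → Even (b - a))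

/-- `G` is an `(l, k)`-ehf-layered-wheel. -/
def IsLayeredWheel {V : Type*} (l k : ℕ) (G : SimpleGraph V) : Prop :=
  ∃ P : ℕ → List V, IsLayering l k G P

/-- `G` contains a pyramid as an induced subgraph: there are three chordless paths of `G`, from
`a` to `b 0`, `b 1`, `b 2`, of length at least one, two of them of length at least two, pairwise
disjoint except at `a`, such that `b 0, b 1, b 2` is a triangle and `G` has no edges between the
paths except those of the triangle and those at `a` (which, the paths being chordless, are the
first edges of the paths). -/
def ContainsPyramid {V : Type*} (G : SimpleGraph V) : Prop :=
  ∃ (a : V) (b : Fin 3 → V) (p : ∀ i, G.Walk a (b i)),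
    (∀ i, (p i).IsPath ∧ (p i).IsChordless ∧ 1 ≤ (p i).length) ∧
    (∃ i, ∀ j, j ≠ i → 2 ≤ (p j).length) ∧
    (∀ i j, i ≠ j → ∀ x, x ∈ (p i).support → x ∈ (p j).support → x = a) ∧
    (∀ i j, i ≠ j → G.Adj (b i) (b j)) ∧
    (∀ i j, i ≠ j → ∀ x ∈ (p i).support, ∀ y ∈ (p j).support, G.Adj x y →
      (x = b i ∧ y = b j) ∨ x = a ∨ y = a)

/-- `G` is pyramid-free. -/
def PyramidFree {V : Type*} (G : SimpleGraph V) : Prop := ¬ ContainsPyramid G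

end EHFWheel

/-! A pyramid is weakened to a triangle `b` together with a connected set `C` avoiding it, in which
the three triangle vertices have unique and pairwise distinct neighbours (`Attached`). This notion
can be pushed down: if the layers 0, …, i+1 contain such a configuration, so do the layers 0, …, i.
Layer 0 is a single vertex and has no triangle, so induction on the layer excludes pyramids.

To push down, take `C` of least size and let X be `C` with the triangle. Two features of the wheel
are decisive: the ancestors of a vertex form a clique, and every vertex with ancestors has, next to
it in the order of such vertices, one with the same ancestors. With minimality they force the part
of X in the top layer to split into subpaths of which exactly the two ends, which are distinct, have
ancestors in X (`Link`, `exists_link`). The ancestors in X of the two ends together are never a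
clique (`not_cliqueAt`): otherwise the interior could be deleted, or `C` would lie inside the link
and contain no neighbour of some triangle vertex.

Heights locate the top vertices with ancestors above the next layer `u`: 2j above `u j`, 2j+1
between `u j` and `u (j + 1)`. A link runs from a smaller to a larger height, and the vertices `u j`
with 2j between these heights lie outside X (`not_mem_of_between`); they replace the link. The lower
vertices of X seen by such a `u j` already had a neighbour in the top part of X
(`exists_represents`), and the attachments of a link are adjacent to its replacement
(`exists_adj_end`), so connectivity, uniqueness and separation carry over. At most one triangle
vertex lies in the top layer; it is an end of a link, the other two are ancestors of the vertex `u
m` beneath it, and `u m` takes its place (`exists_attached_of_b_left`). -/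

namespace EHFWheel

variable {V : Type*} {G : SimpleGraph V}

/-! ### Connectivity inside a vertex set; triangles attached to a connected set. -/

/-- One step along an edge of `G` inside the set `C`. -/
def StepIn (G : SimpleGraph V) (C : Set V) (x y : V) : Prop := x ∈ C ∧ y ∈ C ∧ G.Adj x y

/-- `y` can be reached from `x` inside `C`. -/
abbrev ReachIn (G : SimpleGraph V) (C : Set V) : V → V → Prop :=
  Relation.ReflTransGen (StepIn G C)

theorem ReachIn.symm {C : Set V} {x y : V} (h : ReachIn G C x y) : ReachIn G C y x :=
  have : Std.Symm (StepIn G C) := ⟨fun _ _ h => ⟨h.2.1, h.1, h.2.2.symm⟩⟩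
  Relation.ReflTransGen.stdSymm.symm _ _ h

theorem ReachIn.mono {C D : Set V} (hCD : C ⊆ D) {x y : V} (h : ReachIn G C x y) :
    ReachIn G D x y :=
  h.lift id fun _ _ h => ⟨hCD h.1, hCD h.2.1, h.2.2⟩

theorem ReachIn.single {C : Set V} {x y : V} (hx : x ∈ C) (hy : y ∈ C) (h : G.Adj x y) :
    ReachIn G C x y :=
  Relation.ReflTransGen.single ⟨hx, hy, h⟩

/-- The set `C` induces a connected (or empty) subgraph. -/
def ConnIn (G : SimpleGraph V) (C : Set V) : Prop := ∀ x ∈ C, ∀ y ∈ C, ReachIn G C x y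

/-- Deleting a subset of a connected set leaves a connected set, provided that the outer neighbours
of the deleted part remain connected to each other. -/
theorem ConnIn.diff {C D : Set V} (hC : ConnIn G C)
    (hN : ∀ d ∈ D, ∀ d' ∈ D, ∀ n ∈ C \ D, ∀ n' ∈ C \ D, G.Adj n d → G.Adj n' d' →
      ReachIn G (C \ D) n n') : ConnIn G (C \ D) := by
  intro x hx y hy
  have key : ∀ z, ReachIn G C x z → (z ∉ D → ReachIn G (C \ D) x z) ∧
      (z ∈ D → ∀ n ∈ C \ D, ∀ d ∈ D, G.Adj n d → ReachIn G (C \ D) x n) := by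
    intro z hz
    induction hz with
    | refl => exact ⟨fun _ => .refl, fun h => absurd h hx.2⟩
    | @tail z w hz hzw ih =>
      obtain ⟨hzC, hwC, hadj⟩ := hzw
      by_cases hzD : z ∈ D <;> by_cases hwD : w ∈ D
      · exact ⟨fun h => absurd hwD h, fun _ => ih.2 hzD⟩
      · exact ⟨fun _ => ih.2 hzD w ⟨hwC, hwD⟩ z hzD hadj.symm, fun h => absurd h hwD⟩
      · refine ⟨fun h => absurd hwD h, fun _ n hn d hd hnd => ?_⟩
        exact (ih.1 hzD).trans (hN w hwD d hd z ⟨hzC, hzD⟩ n hn hadj hnd)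
      · exact ⟨fun _ => (ih.1 hzD).tail ⟨⟨hzC, hzD⟩, ⟨hwC, hwD⟩, hadj⟩, fun h => absurd h hwD⟩
  exact (key y (hC x hx.1 y hy.1)).1 hy.2

/-- A triangle `b 0, b 1, b 2` and a connected set `C` outside of it such that each vertex of the
triangle has exactly one neighbour in `C`, these three neighbours being distinct. (An induced
subgraph like this contains a pyramid or a prism.) -/
structure Attached (G : SimpleGraph V) (b : Fin 3 → V) (C : Set V) : Prop where
  tri : ∀ i j, i ≠ j → G.Adj (b i) (b j)
  disj : ∀ i, b i ∉ C
  conn : ConnIn G C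
  nbr : ∀ i, ∃ c ∈ C, G.Adj (b i) c
  uniq : ∀ i, ∀ c ∈ C, ∀ c' ∈ C, G.Adj (b i) c → G.Adj (b i) c' → c = c'
  sep : ∀ i j, ∀ c ∈ C, G.Adj (b i) c → G.Adj (b j) c → i = j

theorem reachIn_of_isPath {a b x : V} (p : G.Walk a b) (hp : p.IsPath) (hx : x ∈ p.support)
    (hxb : x ≠ b) : ReachIn G {y | y ∈ p.support ∧ y ≠ b} a x := by
  induction p with
  | nil => simp at hx; exact absurd hx hxb
  | @cons a c b h p ih =>
    rw [SimpleGraph.Walk.cons_isPath_iff] at hp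
    rw [SimpleGraph.Walk.support_cons, List.mem_cons] at hx
    rcases hx with rfl | hx
    · exact .refl
    · have hcb : c ≠ b := by
        rintro rfl
        have := SimpleGraph.Walk.isPath_iff_nil.1 hp.1
        rw [SimpleGraph.Walk.nil_iff_support_eq.1 this, List.mem_singleton] at hx
        exact hxb hx
      have hab : a ≠ b := fun hab => hp.2 (hab ▸ p.end_mem_support)
      refine .trans (ReachIn.single (by simp [hab]) (by simp [hcb]) h) ((ih hp.1 hx hxb).mono ?_)
      rintro y ⟨hy, hyb⟩
      exact ⟨by simp [hy], hyb⟩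

/-- The set is the union of the three paths without their ends `b i`. Chordlessness makes the
penultimate vertex of its path the only neighbour of `b i`. A common neighbour of two triangle
vertices would be the apex, and then two paths would have length one. -/
theorem ContainsPyramid.exists_attached (h : ContainsPyramid G) :
    ∃ (b : Fin 3 → V) (C : Set V), Attached G b C := by
  obtain ⟨a, b, p, hp, ⟨i₀, hi₀⟩, hdisj, htri, hadj⟩ := h
  have hab : ∀ i, a ≠ b i := by
    intro i hab
    have h1 : (p i).getVert 0 = (p i).getVert (p i).length := by simpa using hab
    have := (hp i).1.getVert_injOn (by simp) (by simp) h1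
    have := (hp i).2.2
    omega
  have hpen : ∀ i c, c ∈ (p i).support → G.Adj (b i) c → c = (p i).penultimate := by
    intro i c hc hbc
    have := (hp i).2.1.mem_edges (p i).end_mem_support hc hbc
    exact (hp i).1.eq_penultimate_of_mem_edges this
  have hsupp : ∀ i c, (∃ j, c ∈ (p j).support ∧ c ≠ b j) → G.Adj (b i) c → c ∈ (p i).support := by
    rintro i c ⟨j, hcj, hne⟩ hbc
    by_cases hij : i = j
    · exact hij ▸ hcj
    · rcases hadj i j hij _ (p i).end_mem_support _ hcj hbc with h | h | h
      · exact absurd h.2 hne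
      · exact absurd h.symm (hab i)
      · rw [h]; exact (p i).start_mem_support
  refine ⟨b, {x | ∃ i, x ∈ (p i).support ∧ x ≠ b i}, htri, ?_, ?_, ?_, ?_, ?_⟩
  · rintro i ⟨j, hj, hne⟩
    have hij : i ≠ j := fun h => hne (h ▸ rfl)
    exact hab i (hdisj i j hij _ (p i).end_mem_support hj).symm
  · have key : ∀ x, (∃ i, x ∈ (p i).support ∧ x ≠ b i) →
        ReachIn G {x | ∃ i, x ∈ (p i).support ∧ x ≠ b i} a x := by
      rintro x ⟨i, hx, hne⟩
      have hsub : {y | y ∈ (p i).support ∧ y ≠ b i} ⊆ {x | ∃ i, x ∈ (p i).support ∧ x ≠ b i} :=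
        fun y hy => ⟨i, hy⟩
      exact (reachIn_of_isPath (p i) (hp i).1 hx hne).mono hsub
    exact fun x hx y hy => (key x hx).symm.trans (key y hy)
  · intro i
    have hnil : ¬ (p i).Nil := by
      rw [SimpleGraph.Walk.not_nil_iff_lt_length]; exact (hp i).2.2
    have := (p i).adj_penultimate hnil
    exact ⟨(p i).penultimate, ⟨i, (p i).getVert_mem_support _, this.ne⟩, this.symm⟩
  · intro i c hc c' hc' h h'
    rw [hpen i c (hsupp i c hc h) h, hpen i c' (hsupp i c' hc' h') h']
  · intro i j c hc h h'
    by_contra hij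
    have hci := hsupp i c hc h
    have hcj := hsupp j c hc h'
    have hca := hdisj i j hij c hci hcj
    have hlen : ∀ i, c ∈ (p i).support → G.Adj (b i) c → (p i).length ≤ 1 := by
      intro i hci h
      have h1 := hpen i c hci h
      replace h1 : (p i).getVert 0 = (p i).getVert ((p i).length - 1) := by
        exact (SimpleGraph.Walk.getVert_zero _).trans (hca.symm.trans h1)
      have := (hp i).1.getVert_injOn (by simp) (by simp) h1
      omega
    have h1 := hlen i hci h
    have h2 := hlen j hcj h'
    have h3 := hi₀ i
    have h4 := hi₀ j
    by_cases hii : i = i₀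
    · have := h4 (fun h => hij (hii.trans h.symm)); omega
    · have := h3 hii; omega

/-! ### Two consecutive layers as a ladder, up to reflection. -/

/-- Coordinates on two consecutive layers. The upper layer is `t p`, `p0 ≤ p ≤ p1`, the lower one
is `u j`, `j0 ≤ j ≤ j1`. A vertex `t p` with ancestors has height `h p = 2 * j` if it lies in an
own zone of `u j` and height `h p = 2 * j + 1` if it lies in the zone shared by the boxes of `u j`
and `u (j + 1)`. -/
structure Strip (V : Type*) where
  p0 : ℤ
  p1 : ℤ
  j0 : ℤ
  j1 : ℤ
  t : ℤ → V
  u : ℤ → V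
  h : ℤ → ℤ

namespace Strip

/-- The indices of the upper layer. -/
def I (D : Strip V) (p : ℤ) : Prop := D.p0 ≤ p ∧ p ≤ D.p1

/-- The indices of the lower layer. -/
def J (D : Strip V) (j : ℤ) : Prop := D.j0 ≤ j ∧ j ≤ D.j1

/-- The ancestors of `t p`. -/
def lab (D : Strip V) (G : SimpleGraph V) (low : Set V) (p : ℤ) : Set V :=
  {s | s ∈ low ∧ G.Adj (D.t p) s}

/-- The ancestors of `u j`. -/
def anc (D : Strip V) (G : SimpleGraph V) (low : Set V) (j : ℤ) : Set V :=
  {s | s ∈ low ∧ G.Adj (D.u j) s ∧ ∀ k, D.J k → s ≠ D.u k}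

/-- The vertex `t p` has ancestors. -/
def Labelled (D : Strip V) (G : SimpleGraph V) (low : Set V) (p : ℤ) : Prop :=
  D.I p ∧ (D.lab G low p).Nonempty

/-- The properties of two consecutive layers of a layered wheel that are used, in a form that is
invariant under exchanging left and right. -/
structure IsLadder (D : Strip V) (G : SimpleGraph V) (low : Set V) : Prop where
  t_not_low : ∀ p, D.I p → D.t p ∉ low
  u_low : ∀ j, D.J j → D.u j ∈ low
  t_adj : ∀ p q, D.I p → D.I q → (G.Adj (D.t p) (D.t q) ↔ p + 1 = q ∨ q + 1 = p)
  u_adj : ∀ j k, D.J j → D.J k → (G.Adj (D.u j) (D.u k) ↔ j + 1 = k ∨ k + 1 = j)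
  t_inj : ∀ p q, D.I p → D.I q → D.t p = D.t q → p = q
  u_inj : ∀ j k, D.J j → D.J k → D.u j = D.u k → j = k
  t_space : ∀ p q, D.Labelled G low p → D.Labelled G low q → q ≠ p + 1
  u_space : ∀ j k, D.J j → D.J k → (D.anc G low j).Nonempty → (D.anc G low k).Nonempty →
    k ≠ j + 1
  h_mono : ∀ p q, D.Labelled G low p → D.Labelled G low q → p ≤ q → D.h p ≤ D.h q
  h_range : ∀ p, D.Labelled G low p → 2 * D.j0 ≤ D.h p ∧ D.h p ≤ 2 * D.j1
  lab_odd : ∀ p j, D.Labelled G low p → D.h p = 2 * j + 1 →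
    ∀ s, s ∈ D.lab G low p ↔ s = D.u j ∨ s = D.u (j + 1)
  lab_even : ∀ p j, D.Labelled G low p → D.h p = 2 * j →
    ∀ s ∈ D.lab G low p, s = D.u j ∨ s ∈ D.anc G low j
  first_own : ∀ j, D.J j → ∃ p, D.Labelled G low p ∧ D.h p = 2 * j ∧ D.lab G low p = {D.u j} ∧
    ∀ q, D.Labelled G low q → D.h q = 2 * j → p ≤ q
  last_own : ∀ j, D.J j → ∃ p, D.Labelled G low p ∧ D.h p = 2 * j ∧ D.lab G low p = {D.u j} ∧
    ∀ q, D.Labelled G low q → D.h q = 2 * j → q ≤ p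
  exists_odd : ∀ j, D.J j → D.J (j + 1) → ∃ p, D.Labelled G low p ∧ D.h p = 2 * j + 1
  anc_first : ∀ j, D.J j → (D.anc G low j).Nonempty → ∃ p, D.Labelled G low p ∧ D.h p = 2 * j ∧
    D.anc G low j ⊆ D.lab G low p ∧
    ∀ q, D.Labelled G low q → D.h q = 2 * j → q < p → ∀ s ∈ D.lab G low q, s = D.u j
  anc_last : ∀ j, D.J j → (D.anc G low j).Nonempty → ∃ p, D.Labelled G low p ∧ D.h p = 2 * j ∧
    D.anc G low j ⊆ D.lab G low p ∧
    ∀ q, D.Labelled G low q → D.h q = 2 * j → p < q → ∀ s ∈ D.lab G low q, s = D.u j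
  mate : ∀ p, D.Labelled G low p → ∃ q, D.Labelled G low q ∧ q ≠ p ∧
    D.lab G low q = D.lab G low p ∧ ∀ r, D.Labelled G low r → ¬ (p < r ∧ r < q) ∧ ¬ (q < r ∧ r < p)
  anc_clique : ∀ j, D.J j → ∀ s ∈ D.anc G low j, ∀ s' ∈ D.anc G low j, s ≠ s' → G.Adj s s'

/-- The reflection of a strip. -/
def rev (D : Strip V) : Strip V where
  p0 := -D.p1
  p1 := -D.p0
  j0 := -D.j1
  j1 := -D.j0
  t p := D.t (-p)
  u j := D.u (-j)
  h p := -D.h (-p)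

variable {D : Strip V} {low : Set V}

theorem rev_I {p : ℤ} : D.rev.I p ↔ D.I (-p) := by
  simp only [I, rev]; omega

theorem rev_J {j : ℤ} : D.rev.J j ↔ D.J (-j) := by
  simp only [J, rev]; omega

theorem rev_lab {p : ℤ} : D.rev.lab G low p = D.lab G low (-p) := rfl

theorem rev_labelled {p : ℤ} : D.rev.Labelled G low p ↔ D.Labelled G low (-p) := by
  simp only [Labelled, rev_I, rev_lab]

theorem rev_anc {j : ℤ} : D.rev.anc G low j = D.anc G low (-j) := by
  ext s
  simp only [anc, Set.mem_ofPred_eq, rev_J]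
  constructor
  · rintro ⟨h1, h2, h3⟩
    refine ⟨h1, h2, fun k hk => ?_⟩
    have := h3 (-k) (by rwa [neg_neg])
    simpa [rev] using this
  · rintro ⟨h1, h2, h3⟩
    exact ⟨h1, h2, fun k hk => h3 _ hk⟩

/-- The axioms are self-dual or come in mirror pairs, so every argument about left ends also serves
right ends. Integer coordinates make the reflection a plain negation. -/
theorem IsLadder.rev (L : D.IsLadder G low) : D.rev.IsLadder G low where
  t_not_low p hp := L.t_not_low _ (rev_I.1 hp)
  u_low j hj := L.u_low _ (rev_J.1 hj)
  t_adj p q hp hq := (L.t_adj _ _ (rev_I.1 hp) (rev_I.1 hq)).trans (by omega)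
  u_adj p q hp hq := (L.u_adj _ _ (rev_J.1 hp) (rev_J.1 hq)).trans (by omega)
  t_inj p q hp hq h := neg_inj.1 (L.t_inj _ _ (rev_I.1 hp) (rev_I.1 hq) h)
  u_inj p q hp hq h := neg_inj.1 (L.u_inj _ _ (rev_J.1 hp) (rev_J.1 hq) h)
  t_space p q hp hq := by
    have := L.t_space _ _ (rev_labelled.1 hq) (rev_labelled.1 hp)
    omega
  u_space j k hj hk := by
    rw [rev_anc, rev_anc]
    intro h1 h2
    have := L.u_space _ _ (rev_J.1 hk) (rev_J.1 hj) h2 h1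
    omega
  h_mono p q hp hq hpq := by
    have := L.h_mono _ _ (rev_labelled.1 hq) (rev_labelled.1 hp) (by omega)
    simp only [Strip.rev]; omega
  h_range p hp := by
    have := L.h_range _ (rev_labelled.1 hp)
    simp only [Strip.rev]; omega
  lab_odd p j hp h s := by
    simp only [Strip.rev] at h
    -- The zone between the reflected indices `j` and `j + 1` is the original zone between `-j - 1`
    -- and `-j`.
    have := L.lab_odd _ (-j - 1) (rev_labelled.1 hp) (by omega) s
    rw [rev_lab, this, or_comm]
    simp only [Strip.rev]
    rw [show -j - 1 + 1 = -j by ring, show -(j + 1) = -j - 1 by ring]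
  lab_even p j hp h s hs := by
    simp only [Strip.rev] at h
    rw [rev_anc]
    exact L.lab_even _ (-j) (rev_labelled.1 hp) (by omega) s hs
  first_own j hj := by
    obtain ⟨p, h1, h2, h3, h4⟩ := L.last_own (-j) (rev_J.1 hj)
    refine ⟨-p, rev_labelled.2 (by rwa [neg_neg]), ?_, ?_, fun q hq hj => ?_⟩
    · simp only [Strip.rev, neg_neg]; omega
    · rw [rev_lab, neg_neg]; exact h3
    · simp only [Strip.rev] at hj
      have := h4 (-q) (rev_labelled.1 hq) (by omega)
      omega
  last_own j hj := by
    obtain ⟨p, h1, h2, h3, h4⟩ := L.first_own (-j) (rev_J.1 hj)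
    refine ⟨-p, rev_labelled.2 (by rwa [neg_neg]), ?_, ?_, fun q hq hj => ?_⟩
    · simp only [Strip.rev, neg_neg]; omega
    · rw [rev_lab, neg_neg]; exact h3
    · simp only [Strip.rev] at hj
      have := h4 (-q) (rev_labelled.1 hq) (by omega)
      omega
  exists_odd j hj hj' := by
    obtain ⟨p, h1, h2⟩ := L.exists_odd (-(j + 1)) (rev_J.1 hj')
      (by rw [show -(j + 1) + 1 = -j by ring]; exact rev_J.1 hj)
    refine ⟨-p, rev_labelled.2 (by rwa [neg_neg]), ?_⟩
    simp only [Strip.rev, neg_neg]; omega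
  anc_first j hj := by
    rw [rev_anc]
    intro hn
    obtain ⟨p, h1, h2, h3, h4⟩ := L.anc_last (-j) (rev_J.1 hj) hn
    refine ⟨-p, rev_labelled.2 (by rwa [neg_neg]), ?_, ?_, fun q hq hj hlt => ?_⟩
    · simp only [Strip.rev, neg_neg]; omega
    · rw [rev_lab, neg_neg]; exact h3
    · simp only [Strip.rev] at hj
      exact h4 (-q) (rev_labelled.1 hq) (by omega) (by omega)
  anc_last j hj := by
    rw [rev_anc]
    intro hn
    obtain ⟨p, h1, h2, h3, h4⟩ := L.anc_first (-j) (rev_J.1 hj) hn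
    refine ⟨-p, rev_labelled.2 (by rwa [neg_neg]), ?_, ?_, fun q hq hj hlt => ?_⟩
    · simp only [Strip.rev, neg_neg]; omega
    · rw [rev_lab, neg_neg]; exact h3
    · simp only [Strip.rev] at hj
      exact h4 (-q) (rev_labelled.1 hq) (by omega) (by omega)
  mate p hp := by
    obtain ⟨q, h1, h2, h3, h4⟩ := L.mate (-p) (rev_labelled.1 hp)
    refine ⟨-q, rev_labelled.2 (by rwa [neg_neg]), by omega, ?_, fun r hr => ?_⟩
    · rw [rev_lab, rev_lab, neg_neg]; exact h3
    · have := h4 (-r) (rev_labelled.1 hr)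
      omega
  anc_clique j hj := by
    rw [rev_anc]
    exact L.anc_clique _ (rev_J.1 hj)

/-- In a shared zone the ancestors are two consecutive vertices of the lower layer; in an own zone
they are among `u j` and its ancestors, which form a clique. -/
theorem IsLadder.lab_clique (L : D.IsLadder G low) {p : ℤ} (hp : D.Labelled G low p) {s s' : V}
    (hs : s ∈ D.lab G low p) (hs' : s' ∈ D.lab G low p) (hne : s ≠ s') : G.Adj s s' := by
  have hr := L.h_range p hp
  obtain ⟨j, hj | hj⟩ := Int.even_or_odd' (D.h p)
  · have hJ : D.J j := ⟨by omega, by omega⟩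
    rcases L.lab_even p j hp hj s hs with rfl | h1 <;>
      rcases L.lab_even p j hp hj s' hs' with rfl | h2
    · exact absurd rfl hne
    · exact h2.2.1
    · exact h1.2.1.symm
    · exact L.anc_clique j hJ _ h1 _ h2 hne
  · have hJ : D.J j := ⟨by omega, by omega⟩
    have hJ' : D.J (j + 1) := ⟨by omega, by omega⟩
    have h3 : G.Adj (D.u j) (D.u (j + 1)) := (L.u_adj _ _ hJ hJ').2 (.inl rfl)
    rcases (L.lab_odd p j hp hj s).1 hs with rfl | rfl <;>
      rcases (L.lab_odd p j hp hj s').1 hs' with rfl | rfl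
    · exact absurd rfl hne
    · exact h3
    · exact h3.symm
    · exact absurd rfl hne

/-- The vertex `t p` has an ancestor in `X`. -/
def Hit (D : Strip V) (G : SimpleGraph V) (low X : Set V) (p : ℤ) : Prop :=
  D.I p ∧ ∃ s ∈ D.lab G low p, s ∈ X

/-- The positions `x < y` are consecutive hits. -/
structure Gap (D : Strip V) (G : SimpleGraph V) (low X : Set V) (x y : ℤ) : Prop where
  lt : x < y
  left : D.Hit G low X x
  right : D.Hit G low X y
  inner : ∀ r, x < r → r < y → ¬ D.Hit G low X r

theorem Hit.labelled {X : Set V} {p : ℤ} (h : D.Hit G low X p) : D.Labelled G low p :=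
  ⟨h.1, h.2.imp fun _ h => h.1⟩

theorem rev_hit {X : Set V} {p : ℤ} : D.rev.Hit G low X p ↔ D.Hit G low X (-p) := by
  simp only [Hit, rev_I, rev_lab]

theorem Gap.rev {X : Set V} {x y : ℤ} (g : D.Gap G low X x y) : D.rev.Gap G low X (-y) (-x) where
  lt := by have := g.lt; omega
  left := rev_hit.2 (by rw [neg_neg]; exact g.right)
  right := rev_hit.2 (by rw [neg_neg]; exact g.left)
  inner r h1 h2 h := g.inner (-r) (by omega) (by omega) (rev_hit.1 h)

/-- The elements of `X` among the ancestors of `t x` and `t y` are pairwise adjacent. -/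
def CliqueAt (D : Strip V) (G : SimpleGraph V) (low X : Set V) (x y : ℤ) : Prop :=
  ∀ s ∈ D.lab G low x ∪ D.lab G low y, ∀ s' ∈ D.lab G low x ∪ D.lab G low y,
    s ∈ X → s' ∈ X → s ≠ s' → G.Adj s s'

theorem CliqueAt.rev {X : Set V} {x y : ℤ} (h : D.CliqueAt G low X x y) :
    D.rev.CliqueAt G low X (-y) (-x) := by
  intro s hs s' hs'
  rw [rev_lab, rev_lab, neg_neg, neg_neg, Set.union_comm] at hs hs'
  exact h s hs s' hs'

end Strip

/-! ### Minimal configurations and gaps with a clique of attachments. -/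

/-- The vertices of a configuration consisting of a triangle and a set `C`. -/
def allVerts (b : Fin 3 → V) (C : Set V) : Set V := C ∪ Set.range b

/-- An inclusion-minimal obstruction in the layers up to the upper layer of a ladder. -/
structure Config (D : Strip V) (G : SimpleGraph V) (low : Set V) (b : Fin 3 → V) (C : Set V) :
    Prop where
  ladder : D.IsLadder G low
  att : Attached G b C
  min : ∀ C', C' ⊂ C → ¬ Attached G b C'
  cover : ∀ x ∈ allVerts b C, x ∈ low ∨ ∃ p, D.I p ∧ x = D.t p

theorem exists_third (i j : Fin 3) : ∃ k, k ≠ i ∧ k ≠ j := by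
  revert i j; decide

namespace Config

variable {D : Strip V} {low : Set V} {b : Fin 3 → V} {C : Set V}

theorem rev (K : Config D G low b C) : Config D.rev G low b C where
  ladder := K.ladder.rev
  att := K.att
  min := K.min
  cover x hx := by
    rcases K.cover x hx with h | ⟨p, hp, rfl⟩
    · exact .inl h
    · exact .inr ⟨-p, Strip.rev_I.2 (by rwa [neg_neg]), by simp [Strip.rev]⟩

theorem b_mem (i : Fin 3) : b i ∈ allVerts b C := .inr ⟨i, rfl⟩

theorem b_inj (K : Config D G low b C) {i j : Fin 3} (h : b i = b j) : i = j := by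
  by_contra hij
  exact (K.att.tri i j hij).ne h

theorem c_ne_b (K : Config D G low b C) {c : V} (hc : c ∈ C) (i : Fin 3) : c ≠ b i :=
  fun h => K.att.disj i (h ▸ hc)

/-- Nothing can be deleted from `C`. -/
theorem prune (K : Config D G low b C) {E : Set V} (hE : E ⊆ C) (hne : E.Nonempty)
    (hb : ∀ d ∈ E, ∀ i, ¬ G.Adj (b i) d)
    (hN : ∀ d ∈ E, ∀ d' ∈ E, ∀ n ∈ C \ E, ∀ n' ∈ C \ E, G.Adj n d → G.Adj n' d' →
      ReachIn G (C \ E) n n') : False := by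
  refine K.min (C \ E) ?_ ⟨K.att.tri, fun i h => K.att.disj i h.1, K.att.conn.diff hN, ?_, ?_, ?_⟩
  · obtain ⟨d, hd⟩ := hne
    exact ⟨Set.sdiff_subset, fun h => (h (hE hd)).2 hd⟩
  · intro i
    obtain ⟨c, hc, h⟩ := K.att.nbr i
    exact ⟨c, ⟨hc, fun hcE => hb c hcE i h⟩, h⟩
  · exact fun i c hc c' hc' => K.att.uniq i c hc.1 c' hc'.1
  · exact fun i j c hc => K.att.sep i j c hc.1

/-- If no edge of `G` leaves a nonempty subset of `C` inside `C`, this subset is `C`. -/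
theorem closed (K : Config D G low b C) {E : Set V} {x : V} (hx : x ∈ C) (hxE : x ∈ E)
    (hE : ∀ c ∈ C, c ∈ E → ∀ c' ∈ C, G.Adj c c' → c' ∈ E) {y : V} (hy : y ∈ C) : y ∈ E := by
  have := K.att.conn x hx y hy
  induction this with
  | refl => exact hxE
  | tail _ h ih => exact hE _ h.1 (ih h.1) _ h.2.1 h.2.2

/-- No vertex is an end vertex of the configuration. -/
theorem two_nbrs (K : Config D G low b C) {x z : V} (hx : x ∈ allVerts b C)
    (h : ∀ y ∈ allVerts b C, G.Adj x y → y = z) : False := by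
  rcases hx with hx | ⟨i, rfl⟩
  · by_cases hb : ∃ i, G.Adj (b i) x
    · obtain ⟨i, hi⟩ := hb
      have hz := h _ (b_mem i) hi.symm
      obtain ⟨j, hj, -⟩ := exists_third i i
      obtain ⟨c, hc, hjc⟩ := K.att.nbr j
      -- The only neighbour of `x` is the triangle vertex `b i`, so connectedness leaves `C = {x}`,
      -- and `x` would serve a second triangle vertex.
      have : c ∈ ({x} : Set V) := by
        refine K.closed (E := {x}) hx rfl (fun c hc hcx c' hc' hcc' => ?_) hc
        rw [Set.mem_singleton_iff] at hcx
        subst hcx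
        have := h c' (.inl hc') hcc'
        exact absurd (this.trans hz.symm) (K.c_ne_b hc' i)
      rw [Set.mem_singleton_iff] at this
      subst this
      exact hj (K.att.sep j i c hc hjc hi)
    · push Not at hb
      refine K.prune (E := {x}) (by simpa using hx) ⟨x, rfl⟩ ?_ ?_
      · rintro d rfl i; exact hb i
      · rintro d rfl d' rfl n hn n' hn' h1 h2
        rw [h n (.inl hn.1) h1.symm, h n' (.inl hn'.1) h2.symm]
  · obtain ⟨j, hj, -⟩ := exists_third i i
    obtain ⟨k, hk, hkj⟩ := exists_third i j
    have h1 := h _ (b_mem j) (K.att.tri i j hj.symm)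
    have h2 := h _ (b_mem k) (K.att.tri i k hk.symm)
    exact hkj (K.b_inj (h2.trans h1.symm))

/-- At most one vertex of the triangle is in the upper layer. -/
theorem b_low (K : Config D G low b C) {i j : Fin 3} {q : ℤ} (hq : D.I q) (hi : b i = D.t q)
    (hij : i ≠ j) : b j ∈ low := by
  have L := K.ladder
  by_contra hj
  obtain ⟨q', hq', hj'⟩ := (K.cover _ (b_mem j)).resolve_left hj
  obtain ⟨k, hki, hkj⟩ := exists_third i j
  have h1 := K.att.tri i j hij
  have h2 := K.att.tri i k hki.symm
  have h3 := K.att.tri j k hkj.symm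
  rw [hi, hj', L.t_adj _ _ hq hq'] at h1
  rw [hi] at h2
  rw [hj'] at h3
  -- A low third vertex would be an ancestor of two consecutive vertices of the upper layer; a high
  -- one would give a triangle in a chordless path.
  rcases K.cover _ (b_mem k) with hk | ⟨r, hr, hk⟩
  · have l1 : D.Labelled G low q := ⟨hq, _, hk, h2⟩
    have l2 : D.Labelled G low q' := ⟨hq', _, hk, h3⟩
    have := L.t_space _ _ l1 l2
    have := L.t_space _ _ l2 l1
    omega
  · rw [hk, L.t_adj _ _ hq hr] at h2
    rw [hk, L.t_adj _ _ hq' hr] at h3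
    omega

theorem hit_of_b (K : Config D G low b C) {i : Fin 3} {q : ℤ} (hq : D.I q) (hi : b i = D.t q) :
    D.Hit G low (allVerts b C) q := by
  obtain ⟨j, hj, -⟩ := exists_third i i
  exact ⟨hq, b j, ⟨K.b_low hq hi hj.symm, hi ▸ K.att.tri i j hj.symm⟩, b_mem j⟩

/-- The alternatives for a gap inside the configuration with a clique of attachments. -/
def Exceptional (D : Strip V) (G : SimpleGraph V) (low : Set V) (b : Fin 3 → V) (C : Set V)
    (p q : ℤ) : Prop :=
  (∀ s ∈ D.lab G low p ∪ D.lab G low q, s ∉ C) ∧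
  (∃ i, ¬ (b i ∈ D.lab G low p ↔ b i ∈ D.lab G low q)) ∧
  ∃ k, ∀ r, p ≤ r → r ≤ q → D.t r ∈ C → ¬ G.Adj (b k) (D.t r)

theorem Exceptional.rev {p q : ℤ} (h : Exceptional D G low b C p q) :
    Exceptional D.rev G low b C (-q) (-p) := by
  obtain ⟨h1, ⟨i, h2⟩, k, h3⟩ := h
  refine ⟨?_, ⟨i, ?_⟩, k, fun r hr hr' => h3 (-r) (by omega) (by omega)⟩
  · simp only [Strip.rev_lab, neg_neg]; rwa [Set.union_comm]
  · simp only [Strip.rev_lab, neg_neg]; rwa [iff_comm]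

variable {p q : ℤ}

/-- The other two triangle vertices are ancestors of `t p`. An attachment in `C` would be adjacent
to both of them, contradicting `sep`. So `t q` is attached to the triangle only, and to just one of
its vertices; the remaining one sees nothing of the gap in `C`. -/
theorem exceptional_of_b_end (K : Config D G low b C) (g : D.Gap G low (allVerts b C) p q)
    (hX : ∀ r, p ≤ r → r ≤ q → D.t r ∈ allVerts b C)
    (hcl : D.CliqueAt G low (allVerts b C) p q) {i : Fin 3} (hi : D.t p = b i) :
    Exceptional D G low b C p q := by
  have L := K.ladder
  have hIp := g.left.1
  have hIq := g.right.1
  have hlow : ∀ j, i ≠ j → b j ∈ D.lab G low p := fun j hj =>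
    ⟨K.b_low hIp hi.symm hj, hi ▸ K.att.tri i j hj⟩
  have hqC : D.t q ∈ C := by
    rcases hX q g.lt.le le_rfl with h | ⟨j, hj⟩
    · exact h
    · by_cases hij : i = j
      · have := L.t_inj _ _ hIp hIq (by rw [hi, hij, hj])
        have := g.lt; omega
      · exact absurd (hj ▸ K.b_low hIp hi.symm hij) (L.t_not_low _ hIq)
  obtain ⟨j₀, hj₀, -⟩ := exists_third i i
  obtain ⟨k₀, hk₀, hkj₀⟩ := exists_third i j₀
  have hsC : ∀ s ∈ D.lab G low p ∪ D.lab G low q, s ∉ C := by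
    intro s hs hsC
    have h1 := hcl _ (.inl (hlow j₀ hj₀.symm)) s hs (b_mem _) (.inl hsC) (K.c_ne_b hsC _).symm
    have h2 := hcl _ (.inl (hlow k₀ hk₀.symm)) s hs (b_mem _) (.inl hsC) (K.c_ne_b hsC _).symm
    exact hkj₀ (K.att.sep _ _ _ hsC h2 h1)
  obtain ⟨-, s, hs, hsX⟩ := g.right
  obtain ⟨j, rfl⟩ : s ∈ Set.range b := hsX.resolve_left (hsC s (.inr hs))
  have hij : i ≠ j := by
    rintro rfl
    exact L.t_not_low _ hIp (hi ▸ hs.1)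
  obtain ⟨k, hki, hkj⟩ := exists_third i j
  have hkq : b k ∉ D.lab G low q := fun h => hkj (K.att.sep _ _ _ hqC h.2.symm hs.2.symm)
  refine ⟨hsC, ⟨k, ?_⟩, k, fun r hr hr' hrC hadj => ?_⟩
  · simp [hkq, hlow k hki.symm]
  · rcases hr.eq_or_lt with rfl | hr
    · exact K.c_ne_b hrC _ hi
    rcases hr'.eq_or_lt with rfl | hr'
    · exact hkq ⟨(hlow k hki.symm).1, hadj.symm⟩
    exact g.inner r hr hr' ⟨⟨by have := hIp.1; omega, by have := hIq.2; omega⟩,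
      b k, ⟨(hlow k hki.symm).1, hadj.symm⟩, b_mem k⟩

/-- The vertex `t p` is already the unique neighbour of `b i` in `C`, so the clique condition
excludes attachments in `C`. Hence `t q` hangs on a different triangle vertex, and the third one can
see neither the ends nor the interior. -/
theorem exceptional_of_b_lab (K : Config D G low b C) (g : D.Gap G low (allVerts b C) p q)
    (hcl : D.CliqueAt G low (allVerts b C) p q) (hpC : D.t p ∈ C) (hqC : D.t q ∈ C) {i : Fin 3}
    (hi : b i ∈ D.lab G low p) : Exceptional D G low b C p q := by
  have L := K.ladder
  have hIp := g.left.1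
  have hIq := g.right.1
  have hsC : ∀ s ∈ D.lab G low p ∪ D.lab G low q, s ∉ C := by
    intro s hs hsC
    have h1 := hcl _ (.inl hi) s hs (b_mem _) (.inl hsC) (K.c_ne_b hsC _).symm
    have h2 := K.att.uniq i _ hsC _ hpC h1 hi.2.symm
    subst h2
    rcases hs with hs | hs <;> exact L.t_not_low _ hIp hs.1
  obtain ⟨-, s, hs, hsX⟩ := g.right
  obtain ⟨j, rfl⟩ : s ∈ Set.range b := hsX.resolve_left (hsC s (.inr hs))
  have hiq : b i ∉ D.lab G low q := by
    intro h
    have := L.t_inj _ _ hIp hIq (K.att.uniq i _ hpC _ hqC hi.2.symm h.2.symm)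
    have := g.lt; omega
  have hij : i ≠ j := by rintro rfl; exact hiq hs
  obtain ⟨k, hki, hkj⟩ := exists_third i j
  refine ⟨hsC, ⟨i, by simp [hi, hiq]⟩, k, fun r hr hr' hrC hadj => ?_⟩
  rcases hr.eq_or_lt with rfl | hr
  · exact hki (K.att.sep _ _ _ hrC hadj hi.2.symm)
  rcases hr'.eq_or_lt with rfl | hr'
  · exact hkj (K.att.sep _ _ _ hrC hadj hs.2.symm)
  have hIr : D.I r := ⟨by have := hIp.1; omega, by have := hIq.2; omega⟩
  rcases K.cover _ (b_mem k) with hk | ⟨r', hr'I, hk⟩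
  · exact g.inner r hr hr' ⟨hIr, b k, ⟨hk, hadj.symm⟩, b_mem k⟩
  · rw [hk, L.t_adj _ _ hr'I hIr] at hadj
    have h1 : r' ≠ p := by rintro rfl; exact K.c_ne_b hpC _ hk.symm
    have h2 : r' ≠ q := by rintro rfl; exact K.c_ne_b hqC _ hk.symm
    exact g.inner r' (by omega) (by omega) (K.hit_of_b hr'I hk)

/-- If neither end touches the triangle, the attachments lie in `C` and are equal or adjacent. They
bypass the gap, whose interior could then be deleted against minimality. -/
theorem exceptional_of_clique (K : Config D G low b C) (g : D.Gap G low (allVerts b C) p q)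
    (hX : ∀ r, p ≤ r → r ≤ q → D.t r ∈ allVerts b C)
    (hcl : D.CliqueAt G low (allVerts b C) p q) : Exceptional D G low b C p q := by
  have L := K.ladder
  have hIp := g.left.1
  have hIq := g.right.1
  have hlt := g.lt
  have hXr : ∀ r, -q ≤ r → r ≤ -p → D.rev.t r ∈ allVerts b C := fun r h h' =>
    hX (-r) (by omega) (by omega)
  rcases hX p le_rfl hlt.le with hpC | ⟨i, hi⟩
  swap
  · exact K.exceptional_of_b_end g hX hcl hi.symm
  rcases hX q hlt.le le_rfl with hqC | ⟨i, hi⟩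
  swap
  · have := (K.rev.exceptional_of_b_end g.rev hXr hcl.rev (i := i)
      (by simp only [Strip.rev, neg_neg]; exact hi.symm)).rev
    simpa [Strip.rev] using this
  by_cases h1 : ∃ i, b i ∈ D.lab G low p
  · obtain ⟨i, hi⟩ := h1
    exact K.exceptional_of_b_lab g hcl hpC hqC hi
  by_cases h2 : ∃ i, b i ∈ D.lab G low q
  · obtain ⟨i, hi⟩ := h2
    have := (K.rev.exceptional_of_b_lab g.rev hcl.rev (i := i)
      (by simpa only [Strip.rev, neg_neg]) (by simpa only [Strip.rev, neg_neg])
      (by simpa only [Strip.rev_lab, neg_neg])).rev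
    simpa [Strip.rev] using this
  exfalso
  push Not at h1 h2
  have hI : ∀ r, p < r → r < q → D.I r := fun r h h' =>
    ⟨by have := hIp.1; omega, by have := hIq.2; omega⟩
  have htC : ∀ r, p ≤ r → r ≤ q → D.t r ∈ C := by
    intro r hr hr'
    rcases hr.eq_or_lt with rfl | hr
    · exact hpC
    rcases hr'.eq_or_lt with rfl | hr'
    · exact hqC
    refine (hX r hr.le hr'.le).resolve_right ?_
    rintro ⟨i, hi⟩
    exact g.inner r hr hr' (K.hit_of_b (hI r hr hr') hi)
  let E : Set V := {x | ∃ r, p < r ∧ r < q ∧ x = D.t r}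
  have hpE : D.t p ∈ C \ E := by
    refine ⟨hpC, ?_⟩
    rintro ⟨r, h, h', he⟩
    have := L.t_inj _ _ hIp (hI r h h') he
    omega
  have hqE : D.t q ∈ C \ E := by
    refine ⟨hqC, ?_⟩
    rintro ⟨r, h, h', he⟩
    have := L.t_inj _ _ hIq (hI r h h') he
    omega
  have hlowE : ∀ s ∈ low, s ∈ C → s ∈ C \ E := by
    rintro s hs hsC
    refine ⟨hsC, ?_⟩
    rintro ⟨r, h, h', rfl⟩
    exact L.t_not_low _ (hI r h h') hs
  have hnb : ∀ d ∈ E, ∀ n ∈ C \ E, G.Adj n d → n = D.t p ∨ n = D.t q := by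
    rintro d ⟨r, h, h', rfl⟩ n hn hadj
    rcases K.cover n (.inl hn.1) with hl | ⟨r', hr', rfl⟩
    · exact absurd ⟨hI r h h', n, ⟨hl, hadj.symm⟩, .inl hn.1⟩ (g.inner r h h')
    · rw [L.t_adj _ _ hr' (hI r h h')] at hadj
      have : ¬ (p < r' ∧ r' < q) := fun hh => hn.2 ⟨r', hh.1, hh.2, rfl⟩
      have : r' = p ∨ r' = q := by omega
      rcases this with rfl | rfl
      · exact .inl rfl
      · exact .inr rfl
  -- The bypass from one end of the gap to the other through one attachment of each end.
  have hpq : ReachIn G (C \ E) (D.t p) (D.t q) := by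
    obtain ⟨-, s, hs, hsX⟩ := g.left
    obtain ⟨-, s', hs', hsX'⟩ := g.right
    have hsC : s ∈ C := hsX.resolve_right (by rintro ⟨i, rfl⟩; exact h1 i hs)
    have hsC' : s' ∈ C := hsX'.resolve_right (by rintro ⟨i, rfl⟩; exact h2 i hs')
    have r1 := ReachIn.single hpE (hlowE s hs.1 hsC) hs.2
    have r2 := ReachIn.single (hlowE s' hs'.1 hsC') hqE hs'.2.symm
    by_cases hss : s = s'
    · subst hss; exact r1.trans r2
    · exact (r1.trans (ReachIn.single (hlowE s hs.1 hsC) (hlowE s' hs'.1 hsC')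
        (hcl s (.inl hs) s' (.inr hs') hsX hsX' hss))).trans r2
  -- The interior contains `t (p + 1)`, because vertices with ancestors are never consecutive in the
  -- upper layer.
  refine K.prune (E := E) ?_ ⟨D.t (p + 1), p + 1, by omega, ?_, rfl⟩ ?_ ?_
  · rintro x ⟨r, h, h', rfl⟩
    exact htC r h.le h'.le
  · have := L.t_space _ _ g.left.labelled g.right.labelled
    omega
  · rintro d ⟨r, h, h', rfl⟩ i hadj
    rcases K.cover _ (b_mem i) with hl | ⟨r', hr', hi⟩
    · exact g.inner r h h' ⟨hI r h h', b i, ⟨hl, hadj.symm⟩, b_mem i⟩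
    · rw [hi, L.t_adj _ _ hr' (hI r h h')] at hadj
      exact K.c_ne_b (htC r' (by omega) (by omega)) i hi.symm
  · intro d hd d' hd' n hn n' hn' hnd hnd'
    rcases hnb d hd n hn hnd with rfl | rfl <;> rcases hnb d' hd' n' hn' hnd' with rfl | rfl
    · exact .refl
    · exact hpq
    · exact hpq.symm
    · exact .refl

/-- Consecutive hits inside the configuration have different ancestors. -/
theorem lab_ne (K : Config D G low b C) (g : D.Gap G low (allVerts b C) p q)
    (hX : ∀ r, p ≤ r → r ≤ q → D.t r ∈ allVerts b C) : D.lab G low p ≠ D.lab G low q := by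
  intro h
  obtain ⟨-, ⟨i, hi⟩, -⟩ := K.exceptional_of_clique g hX (by
    intro s hs s' hs' _ _ hne
    rw [h, Set.union_self] at hs hs'
    exact K.ladder.lab_clique g.right.labelled hs hs' hne)
  exact hi (by rw [h])

end Config

/-! ### Gaps whose attachments are not a clique, and links. -/

namespace Strip

variable {D : Strip V} {low X : Set V} {x y j : ℤ}

theorem rev_rev : D.rev.rev = D := by
  simp [Strip.rev]

namespace IsLadder

theorem cliqueAt_of_subset_left (L : D.IsLadder G low) (hx : D.Labelled G low x)
    (h : D.lab G low y ⊆ D.lab G low x) : D.CliqueAt G low X x y := by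
  intro s hs s' hs' _ _ hne
  rw [Set.union_eq_left.2 h] at hs hs'
  exact L.lab_clique hx hs hs' hne

theorem cliqueAt_of_subset_right (L : D.IsLadder G low) (hy : D.Labelled G low y)
    (h : D.lab G low x ⊆ D.lab G low y) : D.CliqueAt G low X x y := by
  intro s hs s' hs' _ _ hne
  rw [Set.union_eq_right.2 h] at hs hs'
  exact L.lab_clique hy hs hs' hne

theorem cliqueAt_of_even (L : D.IsLadder G low) (hx : D.Labelled G low x)
    (hy : D.Labelled G low y) (h1 : D.h x = 2 * j) (h2 : D.h y = 2 * j) :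
    D.CliqueAt G low X x y := by
  have hJ : D.J j := ⟨by have := L.h_range x hx; omega, by have := L.h_range x hx; omega⟩
  have key : ∀ s ∈ D.lab G low x ∪ D.lab G low y, s = D.u j ∨ s ∈ D.anc G low j := by
    rintro s (hs | hs)
    · exact L.lab_even x j hx h1 s hs
    · exact L.lab_even y j hy h2 s hs
  intro s hs s' hs' _ _ hne
  rcases key s hs with rfl | h1 <;> rcases key s' hs' with rfl | h2
  · exact absurd rfl hne
  · exact h2.2.1
  · exact h1.2.1.symm
  · exact L.anc_clique j hJ _ h1 _ h2 hne

theorem cliqueAt_of_odd (L : D.IsLadder G low) (hx : D.Labelled G low x)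
    (hy : D.Labelled G low y) (h1 : D.h x = 2 * j + 1) (h2 : D.h y = 2 * j + 1) :
    D.CliqueAt G low X x y :=
  L.cliqueAt_of_subset_left hx fun s hs =>
    (L.lab_odd x j hx h1 s).2 ((L.lab_odd y j hy h2 s).1 hs)

/-- A gap inside the box of an element of `X` has a clique of attachments. -/
theorem cliqueAt_of_box (L : D.IsLadder G low) (g : D.Gap G low X x y) (hj : D.J j)
    (hX : D.u j ∈ X) (h1 : 2 * j - 1 ≤ D.h x) (h2 : D.h y ≤ 2 * j + 1) :
    D.CliqueAt G low X x y := by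
  have lx := g.left.labelled
  have ly := g.right.labelled
  have hm := L.h_mono x y lx ly g.lt.le
  have hhit : ∀ p, D.Labelled G low p → D.lab G low p = {D.u j} → D.Hit G low X p :=
    fun p hp h => ⟨hp.1, D.u j, by rw [h]; rfl, hX⟩
  -- The first and last own positions of `u j` have `u j` as their only ancestor, so they are hits.
  -- A gap in the box cannot cross them: it stays at one height or ends at one of them.
  obtain ⟨p, hp1, hp2, hp3, hp4⟩ := L.first_own j hj
  obtain ⟨q, hq1, hq2, hq3, hq4⟩ := L.last_own j hj
  have hxp : D.h x = 2 * j - 1 → x < p := fun h => by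
    by_contra hlt
    have := L.h_mono p x hp1 lx (by omega); omega
  have hqy : D.h y = 2 * j + 1 → q < y := fun h => by
    by_contra hlt
    have := L.h_mono y q ly hq1 (by omega); omega
  have hpin := fun h1 h2 => g.inner p h1 h2 (hhit p hp1 hp3)
  have hqin := fun h1 h2 => g.inner q h1 h2 (hhit q hq1 hq3)
  have hpq := hp4 q hq1 hq2
  have hcase : D.h x = 2 * j - 1 ∨ D.h x = 2 * j ∨ D.h x = 2 * j + 1 := by omega
  rcases hcase with hx | hx | hx
  · have hxp' := hxp hx
    have hcase : D.h y = 2 * j - 1 ∨ D.h y = 2 * j ∨ D.h y = 2 * j + 1 := by omega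
    rcases hcase with hy | hy | hy
    · exact L.cliqueAt_of_odd (j := j - 1) lx ly (by omega) (by omega)
    · have h3 := hp4 y ly hy
      have : p = y := by
        by_contra hne
        exact hpin hxp' (by omega)
      subst this
      refine L.cliqueAt_of_subset_left lx ?_
      rw [hp3]
      rintro s rfl
      exact (L.lab_odd x (j - 1) lx (by omega) _).2 (.inr (by ring_nf))
    · have := hqy hy
      exact absurd (by omega : p < y) (hpin hxp')
  · have hcase : D.h y = 2 * j ∨ D.h y = 2 * j + 1 := by omega
    rcases hcase with hy | hy
    · exact L.cliqueAt_of_even lx ly hx hy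
    · have := hqy hy
      have h3 := hq4 x lx hx
      have : q = x := by
        by_contra hne
        exact hqin (by omega) this
      subst this
      refine L.cliqueAt_of_subset_right ly ?_
      rw [hq3]
      rintro s rfl
      exact (L.lab_odd y j ly hy _).2 (.inl rfl)
  · exact L.cliqueAt_of_odd lx ly hx (by omega)

/-- All ancestors found at one height belong to one clique: `u j` with its ancestors, or `u j` and
`u (j + 1)`. -/
theorem h_lt (L : D.IsLadder G low) (g : D.Gap G low X x y) (hn : ¬ D.CliqueAt G low X x y) :
    D.h x < D.h y := by
  have lx := g.left.labelled
  have ly := g.right.labelled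
  refine (L.h_mono x y lx ly g.lt.le).lt_of_ne fun h => hn ?_
  obtain ⟨j, hj | hj⟩ := Int.even_or_odd' (D.h x)
  · exact L.cliqueAt_of_even lx ly hj (h ▸ hj)
  · exact L.cliqueAt_of_odd lx ly hj (h ▸ hj)

theorem J_of_between (L : D.IsLadder G low) (g : D.Gap G low X x y) (h1 : D.h x ≤ 2 * j)
    (h2 : 2 * j ≤ D.h y) : D.J j := by
  have h3 := L.h_range x g.left.labelled
  have h4 := L.h_range y g.right.labelled
  exact ⟨by omega, by omega⟩

theorem lt_of_h_lt (L : D.IsLadder G low) {p q : ℤ} (hp : D.Labelled G low p)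
    (hq : D.Labelled G low q) (h : D.h p < D.h q) : p < q := by
  by_contra hlt
  have := L.h_mono q p hq hp (by omega)
  omega

/-- If `u j` were in `X`, the shared zone to its right would contain a hit. The gap would end no
later, hence inside the box of `u j`, where attachments are cliques. -/
theorem not_mem_of_left_eq (L : D.IsLadder G low) (g : D.Gap G low X x y)
    (hn : ¬ D.CliqueAt G low X x y) (h1 : D.h x = 2 * j) : D.u j ∉ X := by
  intro hX
  have h2 := L.h_lt g hn
  have hj : D.J j := L.J_of_between g h1.le (by omega)
  have h4 := L.h_range y g.right.labelled
  have hj' : D.J (j + 1) := ⟨by have := hj.1; omega, by omega⟩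
  obtain ⟨p, hp1, hp2⟩ := L.exists_odd j hj hj'
  have hp : D.Hit G low X p := ⟨hp1.1, D.u j, (L.lab_odd p j hp1 hp2 _).2 (.inl rfl), hX⟩
  have hxp := L.lt_of_h_lt g.left.labelled hp1 (by omega)
  have hyp : y ≤ p := by
    by_contra hlt
    exact g.inner p hxp (by omega) hp
  have := L.h_mono y p g.right.labelled hp1 hyp
  exact hn (L.cliqueAt_of_box g hj hX (by omega) (by omega))

/-- The vertices of the lower layer below a gap are not in `X`. -/
theorem not_mem_of_between (L : D.IsLadder G low) (g : D.Gap G low X x y)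
    (hn : ¬ D.CliqueAt G low X x y) (h1 : D.h x ≤ 2 * j) (h2 : 2 * j ≤ D.h y) : D.u j ∉ X := by
  intro hX
  rcases h1.eq_or_lt with h1 | h1
  · exact L.not_mem_of_left_eq g hn h1 hX
  rcases h2.eq_or_lt with h2 | h2
  · refine L.rev.not_mem_of_left_eq (j := -j) g.rev ?_ ?_ ?_
    · exact fun h => hn (by simpa only [rev_rev, neg_neg] using h.rev)
    · simp only [Strip.rev, neg_neg]; omega
    · simpa only [Strip.rev, neg_neg]
  · obtain ⟨p, hp1, hp2, hp3, -⟩ := L.first_own j (L.J_of_between g h1.le h2.le)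
    exact g.inner p (L.lt_of_h_lt g.left.labelled hp1 (by omega))
      (L.lt_of_h_lt hp1 g.right.labelled (by omega)) ⟨hp1.1, D.u j, by rw [hp3]; rfl, hX⟩

/-- The ancestors of a vertex below a gap are attached to an end of the gap. -/
theorem anc_subset_of_between (L : D.IsLadder G low) (g : D.Gap G low X x y)
    (hn : ¬ D.CliqueAt G low X x y) (h1 : D.h x ≤ 2 * j) (h2 : 2 * j ≤ D.h y) {s : V}
    (hs : s ∈ D.anc G low j) (hsX : s ∈ X) :
    (D.h x = 2 * j ∧ D.anc G low j ⊆ D.lab G low x) ∨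
      (D.h y = 2 * j ∧ D.anc G low j ⊆ D.lab G low y) := by
  have hj := L.J_of_between g h1 h2
  have hu := L.not_mem_of_between g hn h1 h2
  have hlt := L.h_lt g hn
  have lx := g.left.labelled
  have ly := g.right.labelled
  -- Both `p` and `q` see all ancestors of `u j`, in particular `s`, so they are hits and cannot be
  -- interior. Own positions before `p` or after `q` see only `u j`, which is not in `X`; this pins
  -- an end of the gap to `q` or `p`.
  obtain ⟨p, hp1, hp2, hp3, hp4⟩ := L.anc_first j hj ⟨s, hs⟩
  obtain ⟨q, hq1, hq2, hq3, hq4⟩ := L.anc_last j hj ⟨s, hs⟩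
  have hp : D.Hit G low X p := ⟨hp1.1, s, hp3 hs, hsX⟩
  have hq : D.Hit G low X q := ⟨hq1.1, s, hq3 hs, hsX⟩
  rcases h1.eq_or_lt with h1 | h1
  · left
    have hqy : q < y := L.lt_of_h_lt hq1 ly (by omega)
    have hqx : q ≤ x := by
      by_contra h
      exact g.inner q (by omega) hqy hq
    rcases hqx.eq_or_lt with rfl | hqx
    · exact ⟨h1, hq3⟩
    · obtain ⟨-, s', hs', hsX'⟩ := g.left
      exact absurd (hq4 x lx h1 hqx s' hs' ▸ hsX') hu
  · have hxp : x < p := L.lt_of_h_lt lx hp1 (by omega)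
    have hyp : y ≤ p := by
      by_contra h
      exact g.inner p hxp (by omega) hp
    have := L.h_mono y p ly hp1 hyp
    have h2 : D.h y = 2 * j := by omega
    right
    rcases hyp.eq_or_lt with rfl | hyp
    · exact ⟨h2, hp3⟩
    · obtain ⟨-, s', hs', hsX'⟩ := g.right
      exact absurd (hp4 y ly h2 hyp s' hs' ▸ hsX') hu

end IsLadder

/-- The positions from `x` to `y` form a component of the part of `X` in the upper layer; exactly
its two ends have ancestors in `X`. -/
structure Link (D : Strip V) (G : SimpleGraph V) (low X : Set V) (x y : ℤ) : Prop
    extends D.Gap G low X x y where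
  mem : ∀ r, x ≤ r → r ≤ y → D.t r ∈ X
  left_max : D.I (x - 1) → D.t (x - 1) ∉ X
  right_max : D.I (y + 1) → D.t (y + 1) ∉ X

theorem Link.rev (k : D.Link G low X x y) : D.rev.Link G low X (-y) (-x) where
  toGap := k.toGap.rev
  mem r h h' := k.mem (-r) (by omega) (by omega)
  left_max h := by
    rw [rev_I, show -(-y - 1) = y + 1 by ring] at h
    simp only [Strip.rev, show -(-y - 1) = y + 1 by ring]
    exact k.right_max h
  right_max h := by
    rw [rev_I, show -(-x + 1) = x - 1 by ring] at h
    simp only [Strip.rev, show -(-x + 1) = x - 1 by ring]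
    exact k.left_max h

theorem Link.I_mem (k : D.Link G low X x y) {r : ℤ} (h : x ≤ r) (h' : r ≤ y) : D.I r :=
  ⟨k.left.1.1.trans h, h'.trans k.right.1.2⟩

theorem Link.eq_of_hit (k : D.Link G low X x y) {r : ℤ} (h : x ≤ r) (h' : r ≤ y)
    (hr : D.Hit G low X r) : r = x ∨ r = y := by
  by_contra hne
  exact k.inner r (by omega) (by omega) hr

/-- Links that overlap are equal. -/
theorem Link.eq (k : D.Link G low X x y) {x' y' r : ℤ} (k' : D.Link G low X x' y') (h1 : x ≤ r)
    (h2 : r ≤ y) (h1' : x' ≤ r) (h2' : r ≤ y') : x = x' ∧ y = y' := by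
  have a1 : ¬ x < x' := fun h => k'.left_max (k.I_mem (by omega) (by omega))
    (k.mem _ (by omega) (by omega))
  have a2 : ¬ x' < x := fun h => k.left_max (k'.I_mem (by omega) (by omega))
    (k'.mem _ (by omega) (by omega))
  have a3 : ¬ y < y' := fun h => k.right_max (k'.I_mem (by omega) (by omega))
    (k'.mem _ (by omega) (by omega))
  have a4 : ¬ y' < y := fun h => k'.right_max (k.I_mem (by omega) (by omega))
    (k.mem _ (by omega) (by omega))
  omega

theorem exists_left_end {X : Set V} {q : ℤ} (D : Strip V) (hq : D.I q) (hX : D.t q ∈ X) :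
    ∃ x ≤ q, D.I x ∧ (∀ r, x ≤ r → r ≤ q → D.t r ∈ X) ∧
      (D.I (x - 1) → D.t (x - 1) ∉ X) := by
  obtain ⟨x, ⟨h1, h2, h3⟩, h4⟩ := Int.exists_least_of_bdd
    (P := fun x => D.p0 ≤ x ∧ x ≤ q ∧ ∀ r, x ≤ r → r ≤ q → D.t r ∈ X)
    ⟨D.p0, fun z hz => hz.1⟩ ⟨q, hq.1, le_rfl, fun r h h' => (le_antisymm h h') ▸ hX⟩
  refine ⟨x, h2, ⟨h1, h2.trans hq.2⟩, h3, fun hI hx => ?_⟩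
  have := h4 (x - 1) ⟨hI.1, by omega, fun r h h' => ?_⟩
  · omega
  · rcases h.eq_or_lt with rfl | h
    · exact hx
    · exact h3 r (by omega) h'

theorem exists_right_end {X : Set V} {q : ℤ} (D : Strip V) (hq : D.I q) (hX : D.t q ∈ X) :
    ∃ y, q ≤ y ∧ D.I y ∧ (∀ r, q ≤ r → r ≤ y → D.t r ∈ X) ∧
      (D.I (y + 1) → D.t (y + 1) ∉ X) := by
  obtain ⟨x, h1, h2, h3, h4⟩ := D.rev.exists_left_end (q := -q) (rev_I.2 (by rwa [neg_neg]))
    (by simpa only [Strip.rev, neg_neg])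
  refine ⟨-x, by omega, rev_I.1 h2, fun r h h' => ?_, fun h => ?_⟩
  · have := h3 (-r) (by omega) (by omega)
    simpa only [Strip.rev, neg_neg] using this
  · have e : -(x - 1) = -x + 1 := by ring
    have := h4 (rev_I.2 (by rwa [e]))
    simpa only [Strip.rev, e] using this

end Strip

/-! ### The upper part of a minimal configuration is a union of links. -/

namespace Config

open Strip

variable {D : Strip V} {low : Set V} {b : Fin 3 → V} {C : Set V} {x y q : ℤ}

/-- Without an ancestor in the configuration, `t x` could have no neighbour there except `t (x +
1)`. -/
theorem hit_of_left_end (K : Config D G low b C) (hx : D.I x) (hX : D.t x ∈ allVerts b C)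
    (h : D.I (x - 1) → D.t (x - 1) ∉ allVerts b C) : D.Hit G low (allVerts b C) x := by
  by_contra hn
  refine K.two_nbrs (z := D.t (x + 1)) hX fun z hz hadj => ?_
  rcases K.cover z hz with hl | ⟨r, hr, rfl⟩
  · exact absurd ⟨hx, z, ⟨hl, hadj⟩, hz⟩ hn
  · rcases (K.ladder.t_adj _ _ hx hr).1 hadj with rfl | rfl
    · rfl
    · rw [add_sub_cancel_right] at h
      exact absurd hz (h hr)

theorem hit_of_right_end (K : Config D G low b C) (hx : D.I x) (hX : D.t x ∈ allVerts b C)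
    (h : D.I (x + 1) → D.t (x + 1) ∉ allVerts b C) : D.Hit G low (allVerts b C) x := by
  have e : -(-x - 1) = x + 1 := by ring
  have := K.rev.hit_of_left_end (x := -x) (rev_I.2 (by rwa [neg_neg]))
    (by simpa only [Strip.rev, neg_neg]) (by rw [rev_I, e]; simpa only [Strip.rev, e])
  simpa only [rev_hit, neg_neg] using this

/-- No component of the configuration in the upper layer is a single vertex. -/
theorem not_isolated (K : Config D G low b C) (hx : D.I x) (hX : D.t x ∈ allVerts b C)
    (h1 : D.I (x - 1) → D.t (x - 1) ∉ allVerts b C)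
    (h2 : D.I (x + 1) → D.t (x + 1) ∉ allVerts b C) : False := by
  have L := K.ladder
  have hl := (K.hit_of_left_end hx hX h1).labelled
  -- All neighbours of `t x` in the configuration are ancestors, hence pairwise adjacent; such a
  -- vertex is either removable or violates uniqueness or separation.
  have hlab : ∀ z ∈ allVerts b C, G.Adj (D.t x) z → z ∈ D.lab G low x := by
    intro z hz hadj
    rcases K.cover z hz with hlow | ⟨r, hr, rfl⟩
    · exact ⟨hlow, hadj⟩
    · rcases (L.t_adj _ _ hx hr).1 hadj with rfl | rfl
      · exact absurd hz (h2 hr)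
      · rw [add_sub_cancel_right] at h1
        exact absurd hz (h1 hr)
  rcases hX with hC | ⟨i, hi⟩
  · by_cases hb : ∃ i, b i ∈ D.lab G low x
    · obtain ⟨i, hi⟩ := hb
      obtain ⟨j, hj, -⟩ := exists_third i i
      obtain ⟨c, hc, hjc⟩ := K.att.nbr j
      have : c ∈ ({D.t x} : Set V) := by
        refine K.closed (E := {D.t x}) hC rfl (fun c hc hcx c' hc' hcc' => ?_) hc
        obtain rfl : c = D.t x := hcx
        have hl' := hlab c' (.inl hc') hcc'
        have := L.lab_clique hl hi hl' (K.c_ne_b hc' i).symm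
        exact K.att.uniq i _ hc' _ hc this hi.2.symm
      obtain rfl : c = D.t x := this
      exact hj (K.att.sep _ _ _ hc hjc hi.2.symm)
    · push Not at hb
      refine K.prune (E := {D.t x}) (by simpa using hC) ⟨_, rfl⟩ ?_ ?_
      · rintro d rfl i hadj
        exact hb i (hlab _ (b_mem i) hadj.symm)
      · rintro d rfl d' rfl n hn n' hn' hadj hadj'
        by_cases hnn : n = n'
        · exact hnn ▸ .refl
        · exact ReachIn.single hn hn' (L.lab_clique hl (hlab n (.inl hn.1) hadj.symm)
            (hlab n' (.inl hn'.1) hadj'.symm) hnn)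
  · obtain ⟨j, hj, -⟩ := exists_third i i
    obtain ⟨k, hk, hkj⟩ := exists_third i j
    obtain ⟨c, hc, hic⟩ := K.att.nbr i
    have hlab' : ∀ z ∈ allVerts b C, G.Adj (b i) z → z ∈ D.lab G low x := by
      rw [hi]; exact hlab
    have hcl := hlab' c (.inl hc) hic
    have a1 := L.lab_clique hl (hlab' _ (b_mem j) (K.att.tri _ _ hj.symm)) hcl
      (K.c_ne_b hc j).symm
    have a2 := L.lab_clique hl (hlab' _ (b_mem k) (K.att.tri _ _ hk.symm)) hcl
      (K.c_ne_b hc k).symm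
    exact hkj (K.att.sep _ _ _ hc a2 a1)

/-- Every vertex of the configuration in the upper layer lies in a link. -/
theorem exists_link (K : Config D G low b C) (hq : D.I q) (hX : D.t q ∈ allVerts b C) :
    ∃ x y, D.Link G low (allVerts b C) x y ∧ x ≤ q ∧ q ≤ y := by
  obtain ⟨x, hxq, hx, hx1, hx2⟩ := D.exists_left_end hq hX
  obtain ⟨y, hqy, hy, hy1, hy2⟩ := D.exists_right_end hq hX
  have hmem : ∀ r, x ≤ r → r ≤ y → D.t r ∈ allVerts b C := by
    intro r h h'
    rcases le_total r q with h'' | h''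
    · exact hx1 r h h''
    · exact hy1 r h'' h'
  have hhx := K.hit_of_left_end hx (hmem x le_rfl (by omega)) hx2
  have hhy := K.hit_of_right_end hy (hmem y (by omega) le_rfl) hy2
  have hlt : x < y := by
    refine (hxq.trans hqy).lt_of_ne ?_
    rintro rfl
    exact K.not_isolated hx (hmem x le_rfl le_rfl) hx2 hy2
  refine ⟨x, y, ⟨⟨hlt, hhx, hhy, fun r h1 h2 hr => ?_⟩, hmem, hx2, hy2⟩, hxq, hqy⟩
  -- An interior hit has an adjacent position, among those with ancestors, with the same ancestors.
  -- That position cannot jump over `x` or `y`, so it stays in the segment, against `lab_ne`.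
  obtain ⟨p, hp1, hp2, hp3, hp4⟩ := K.ladder.mate r hr.labelled
  have hp : D.Hit G low (allVerts b C) p := ⟨hp1.1, by rw [hp3]; exact hr.2⟩
  have hpx := hp4 x hhx.labelled
  have hpy := hp4 y hhy.labelled
  rcases lt_or_gt_of_ne hp2 with hlt | hlt
  · exact K.lab_ne ⟨hlt, hp, hr, fun s h h' hs => (hp4 s hs.labelled).2 ⟨h, h'⟩⟩
      (fun s h h' => hmem s (by omega) (by omega)) hp3
  · exact K.lab_ne ⟨hlt, hr, hp, fun s h h' hs => (hp4 s hs.labelled).1 ⟨h, h'⟩⟩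
      (fun s h h' => hmem s (by omega) (by omega)) hp3.symm

theorem mem_C_of_inner (K : Config D G low b C) (k : D.Link G low (allVerts b C) x y)
    (h : x < q) (h' : q < y) : D.t q ∈ C := by
  refine (k.mem q h.le h'.le).resolve_right ?_
  rintro ⟨i, hi⟩
  exact k.inner q h h' (K.hit_of_b (k.I_mem h.le h'.le) hi)

/-- In the exceptional case the link has no attachment in `C`. Being maximal in the upper layer, it
then contains all of `C` by connectedness, yet some triangle vertex sees none of it. -/
theorem not_cliqueAt (K : Config D G low b C) (k : D.Link G low (allVerts b C) x y) :
    ¬ D.CliqueAt G low (allVerts b C) x y := by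
  intro hcl
  obtain ⟨h1, -, i, hi⟩ := K.exceptional_of_clique k.toGap k.mem hcl
  have hlt := k.lt
  have := K.ladder.t_space _ _ k.left.labelled k.right.labelled
  obtain ⟨c, hc, hic⟩ := K.att.nbr i
  have hcE : c ∈ {z | ∃ r, x ≤ r ∧ r ≤ y ∧ z = D.t r} := by
    refine K.closed (E := {z | ∃ r, x ≤ r ∧ r ≤ y ∧ z = D.t r}) (K.mem_C_of_inner k (q := x + 1) (by omega) (by omega))
      ⟨x + 1, by omega, by omega, rfl⟩ ?_ hc
    rintro c hc ⟨r, hr, hr', rfl⟩ c' hc' hadj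
    rcases K.cover c' (.inl hc') with hlow | ⟨r', hrI, rfl⟩
    · rcases k.eq_of_hit hr hr' ⟨k.I_mem hr hr', c', ⟨hlow, hadj⟩, .inl hc'⟩ with rfl | rfl
      · exact absurd hc' (h1 c' (.inl ⟨hlow, hadj⟩))
      · exact absurd hc' (h1 c' (.inr ⟨hlow, hadj⟩))
    · rw [K.ladder.t_adj _ _ (k.I_mem hr hr') hrI] at hadj
      refine ⟨r', ?_, ?_, rfl⟩
      · by_contra hlt
        obtain rfl : r' = x - 1 := by omega
        exact k.left_max hrI (.inl hc')
      · by_contra hlt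
        obtain rfl : r' = y + 1 := by omega
        exact k.right_max hrI (.inl hc')
  obtain ⟨r, hr, hr', rfl⟩ := hcE
  exact hi r hr hr' hc hic

end Config

/-! ### Replacing links by the vertices below them. -/

namespace Strip

variable {D : Strip V} {low X : Set V} {x y j k p : ℤ} {s : V}

theorem rev_link : D.rev.Link G low X x y ↔ D.Link G low X (-y) (-x) := by
  constructor
  · intro h; simpa only [rev_rev] using h.rev
  · intro h; simpa only [neg_neg] using h.rev

theorem IsLadder.h_of_mid (L : D.IsLadder G low) (hp : D.Labelled G low p) (hk : D.J k)
    (h : D.u k ∈ D.lab G low p) : 2 * k - 1 ≤ D.h p ∧ D.h p ≤ 2 * k + 1 := by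
  have hr := L.h_range p hp
  obtain ⟨m, hm | hm⟩ := Int.even_or_odd' (D.h p)
  · rcases L.lab_even p m hp hm _ h with h | h
    · have := L.u_inj _ _ hk ⟨by omega, by omega⟩ h
      omega
    · exact absurd rfl (h.2.2 k hk)
  · rcases (L.lab_odd p m hp hm _).1 h with h | h
    · have := L.u_inj _ _ hk ⟨by omega, by omega⟩ h
      omega
    · have := L.u_inj _ _ hk ⟨by omega, by omega⟩ h
      omega

/-- The neighbours of `u j` in the lower layers. -/
theorem IsLadder.low_nbr (L : D.IsLadder G low) (hj : D.J j) (hs : s ∈ low)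
    (h : G.Adj (D.u j) s) :
    s ∈ D.anc G low j ∨ (D.J (j + 1) ∧ s = D.u (j + 1)) ∨ (D.J (j - 1) ∧ s = D.u (j - 1)) := by
  by_cases hm : ∃ k, D.J k ∧ s = D.u k
  · obtain ⟨k, hk, rfl⟩ := hm
    rcases (L.u_adj _ _ hj hk).1 h with rfl | rfl
    · exact .inr (.inl ⟨hk, rfl⟩)
    · rw [add_sub_cancel_right]
      exact .inr (.inr ⟨hk, rfl⟩)
  · push Not at hm
    exact .inl ⟨hs, h, hm⟩

/-- The vertices of the lower layer below the links. -/
def below (D : Strip V) (G : SimpleGraph V) (low X : Set V) : Set V :=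
  {v | ∃ x y j, D.Link G low X x y ∧ D.h x ≤ 2 * j ∧ 2 * j ≤ D.h y ∧ v = D.u j}

/-- The vertex `t p` takes the place of `u j` as a neighbour of `s`. -/
def Represents (D : Strip V) (G : SimpleGraph V) (low : Set V) (s : V) (j p : ℤ) : Prop :=
  s ∈ D.lab G low p ∧
    ((s ∈ D.anc G low j ∧ D.h p = 2 * j ∧ D.anc G low j ⊆ D.lab G low p) ∨
      (D.J (j + 1) ∧ s = D.u (j + 1) ∧ D.h p = 2 * j + 1) ∨
      (D.J (j - 1) ∧ s = D.u (j - 1) ∧ D.h p = 2 * j - 1))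

end Strip

namespace Config

open Strip

variable {D : Strip V} {low : Set V} {b : Fin 3 → V} {C : Set V} {x y x' y' j p : ℤ} {s v : V}

theorem h_lt (K : Config D G low b C) (k : D.Link G low (allVerts b C) x y) : D.h x < D.h y :=
  K.ladder.h_lt k.toGap (K.not_cliqueAt k)

theorem not_mem (K : Config D G low b C) (k : D.Link G low (allVerts b C) x y)
    (h1 : D.h x ≤ 2 * j) (h2 : 2 * j ≤ D.h y) : D.u j ∉ allVerts b C :=
  K.ladder.not_mem_of_between k.toGap (K.not_cliqueAt k) h1 h2

theorem below_disjoint (K : Config D G low b C)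
    (hv : v ∈ D.below G low (allVerts b C)) : v ∉ allVerts b C := by
  obtain ⟨x, y, j, k, h1, h2, rfl⟩ := hv
  exact K.not_mem k h1 h2

theorem below_low (K : Config D G low b C)
    (hv : v ∈ D.below G low (allVerts b C)) : v ∈ low := by
  obtain ⟨x, y, j, k, h1, h2, rfl⟩ := hv
  exact K.ladder.u_low _ (K.ladder.J_of_between k.toGap h1 h2)

/-- Every vertex of the configuration in the upper layer that has an ancestor in the configuration
is an end of a link. -/
theorem exists_link_of_hit (K : Config D G low b C) (hX : D.t p ∈ allVerts b C)
    (hp : D.Hit G low (allVerts b C) p) :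
    ∃ x y, D.Link G low (allVerts b C) x y ∧ (p = x ∨ p = y) := by
  obtain ⟨x, y, k, h1, h2⟩ := K.exists_link hp.1 hX
  exact ⟨x, y, k, k.eq_of_hit h1 h2 hp⟩

/-- Each of two such links rises above the common starting height, so the later starting point would
be a hit inside the earlier link. -/
theorem left_unique (K : Config D G low b C) (k : D.Link G low (allVerts b C) x y)
    (k' : D.Link G low (allVerts b C) x' y') (h : D.h x = D.h x') : x = x' := by
  have h1 := K.ladder.lt_of_h_lt k'.left.labelled k.right.labelled (h ▸ K.h_lt k)
  have h2 := K.ladder.lt_of_h_lt k.left.labelled k'.right.labelled (h ▸ K.h_lt k')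
  rcases lt_trichotomy x x' with hlt | rfl | hlt
  · exact absurd k'.left (k.inner _ hlt h1)
  · rfl
  · exact absurd k.left (k'.inner _ hlt h2)

/-- A link reaching beyond height `2 * j` is stopped by the hits in the zone shared by `u j` and `u
(j + 1)`. If it stops at `2 * j`, and no link ends at `2 * j + 1`, then `u (j + 1)` has at most one
neighbour in the configuration, against `two_nbrs`. -/
theorem exists_link_right (K : Config D G low b C) (k : D.Link G low (allVerts b C) x y)
    (h1 : D.h x ≤ 2 * j) (h2 : 2 * j ≤ D.h y) (hj : D.J (j + 1))
    (hX : D.u (j + 1) ∈ allVerts b C) :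
    ∃ x' y', D.Link G low (allVerts b C) x' y' ∧ D.h y' = 2 * j + 1 := by
  have L := K.ladder
  have hj0 := L.J_of_between k.toGap h1 h2
  rcases h2.eq_or_lt with h2 | h2
  swap
  · obtain ⟨q, hq1, hq2⟩ := L.exists_odd j hj0 hj
    have hq : D.Hit G low (allVerts b C) q :=
      ⟨hq1.1, _, (L.lab_odd q j hq1 hq2 _).2 (.inr rfl), hX⟩
    have hxq := L.lt_of_h_lt k.left.labelled hq1 (by omega)
    have hyq : y ≤ q := by
      by_contra h
      exact k.inner q hxq (by omega) hq
    have := L.h_mono y q k.right.labelled hq1 hyq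
    exact ⟨x, y, k, by omega⟩
  · have hu : D.u j ∉ allVerts b C := K.not_mem k h1 h2.le
    -- Since `u j` is outside the configuration, the hit at `y` comes from an ancestor of `u j`;
    -- consecutive vertices of the lower layer cannot both have ancestors.
    have hanc : ¬ (D.anc G low (j + 1)).Nonempty := by
      intro hne
      obtain ⟨-, s, hs, hsX⟩ := k.right
      rcases L.lab_even y j k.right.labelled h2.symm s hs with rfl | h
      · exact hu hsX
      · exact L.u_space j (j + 1) hj0 hj ⟨s, h⟩ hne rfl
    by_contra hno
    push Not at hno
    have hlow : ∀ z ∈ allVerts b C, z ∈ low → G.Adj (D.u (j + 1)) z → z = D.u (j + 2) := by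
      intro z hz hzl hadj
      rcases L.low_nbr hj hzl hadj with h | ⟨-, h⟩ | ⟨-, h⟩
      · exact absurd ⟨z, h⟩ hanc
      · rw [h]; ring_nf
      · rw [add_sub_cancel_right] at h
        exact absurd (h ▸ hz) hu
    -- Any link meeting the box of `u (j + 1)` in another way would pass height `2 * (j + 1)` and
    -- push `u (j + 1)` out of the configuration. What remains is a left end at `2 * j + 3`, which
    -- is unique and puts `u (j + 2)` below its link.
    have htop : ∀ q, D.I q → D.t q ∈ allVerts b C → G.Adj (D.u (j + 1)) (D.t q) →
        ∃ y', D.Link G low (allVerts b C) q y' ∧ D.h q = 2 * j + 3 := by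
      intro q hq hqX hadj
      have hlab : D.u (j + 1) ∈ D.lab G low q := ⟨L.u_low _ hj, hadj.symm⟩
      have hhit : D.Hit G low (allVerts b C) q := ⟨hq, _, hlab, hX⟩
      have hh := L.h_of_mid hhit.labelled hj hlab
      obtain ⟨x', y', k', h | h⟩ := K.exists_link_of_hit hqX hhit
      · subst h
        have := K.h_lt k'
        have : ¬ (D.h q ≤ 2 * (j + 1) ∧ 2 * (j + 1) ≤ D.h y') := fun h =>
          K.not_mem k' h.1 h.2 hX
        exact ⟨y', k', by omega⟩
      · subst h
        have := K.h_lt k'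
        have := hno x' q k'
        have : ¬ (D.h x' ≤ 2 * (j + 1) ∧ 2 * (j + 1) ≤ D.h q) := fun h =>
          K.not_mem k' h.1 h.2 hX
        omega
    by_cases h3 : ∃ q, D.I q ∧ D.t q ∈ allVerts b C ∧ G.Adj (D.u (j + 1)) (D.t q)
    · obtain ⟨q, hq, hqX, hadj⟩ := h3
      obtain ⟨y', k', hh⟩ := htop q hq hqX hadj
      refine K.two_nbrs (z := D.t q) hX fun z hz hzadj => ?_
      rcases K.cover z hz with hzl | ⟨r, hr, rfl⟩
      · obtain rfl := hlow z hz hzl hzadj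
        have := K.h_lt k'
        exact absurd hz (K.not_mem k' (by omega) (by omega))
      · obtain ⟨y'', k'', hh'⟩ := htop r hr hz hzadj
        rw [K.left_unique k' k'' (hh.trans hh'.symm)]
    · refine K.two_nbrs (z := D.u (j + 2)) hX fun z hz hzadj => ?_
      rcases K.cover z hz with hzl | ⟨r, hr, rfl⟩
      · exact hlow z hz hzl hzadj
      · exact absurd ⟨r, hr, hz, hzadj⟩ h3

theorem exists_link_left (K : Config D G low b C) (k : D.Link G low (allVerts b C) x y)
    (h1 : D.h x ≤ 2 * j) (h2 : 2 * j ≤ D.h y) (hj : D.J (j - 1))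
    (hX : D.u (j - 1) ∈ allVerts b C) :
    ∃ x' y', D.Link G low (allVerts b C) x' y' ∧ D.h x' = 2 * j - 1 := by
  have e : -(-j + 1) = j - 1 := by ring
  obtain ⟨x', y', k', h⟩ := K.rev.exists_link_right (j := -j) k.rev
    (by simp only [Strip.rev, neg_neg]; omega) (by simp only [Strip.rev, neg_neg]; omega)
    (by rwa [rev_J, e]) (by simpa only [Strip.rev, e])
  refine ⟨-y', -x', rev_link.1 k', ?_⟩
  simp only [Strip.rev] at h
  omega

/-- The neighbours of `u j` in the configuration have neighbours in the upper layer instead. -/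
theorem exists_represents (K : Config D G low b C) (k : D.Link G low (allVerts b C) x y)
    (h1 : D.h x ≤ 2 * j) (h2 : 2 * j ≤ D.h y) (hs : s ∈ low) (hsX : s ∈ allVerts b C)
    (hadj : G.Adj s (D.u j)) :
    ∃ p, D.I p ∧ D.t p ∈ allVerts b C ∧ D.Represents G low s j p := by
  have L := K.ladder
  have hJ := L.J_of_between k.toGap h1 h2
  rcases L.low_nbr hJ hs hadj.symm with h | ⟨hJ', rfl⟩ | ⟨hJ', rfl⟩
  · rcases L.anc_subset_of_between k.toGap (K.not_cliqueAt k) h1 h2 h hsX with ⟨h3, h4⟩ | ⟨h3, h4⟩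
    · exact ⟨x, k.left.1, k.mem x le_rfl k.lt.le, h4 h, .inl ⟨h, h3, h4⟩⟩
    · exact ⟨y, k.right.1, k.mem y k.lt.le le_rfl, h4 h, .inl ⟨h, h3, h4⟩⟩
  · obtain ⟨x', y', k', h3⟩ := K.exists_link_right k h1 h2 hJ' hsX
    refine ⟨y', k'.right.1, k'.mem y' k'.lt.le le_rfl, ?_, .inr (.inl ⟨hJ', rfl, h3⟩)⟩
    exact (L.lab_odd y' j k'.right.labelled h3 _).2 (.inr rfl)
  · obtain ⟨x', y', k', h3⟩ := K.exists_link_left k h1 h2 hJ' hsX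
    refine ⟨x', k'.left.1, k'.mem x' le_rfl k'.lt.le, ?_, .inr (.inr ⟨hJ', rfl, h3⟩)⟩
    exact (L.lab_odd x' (j - 1) k'.left.labelled (by omega) _).2 (.inl rfl)

/-- At even height `2 * m` the vertex `s` is an ancestor of `u m`, as `u m` is outside the
configuration. At height `2 * m + 1` the same reason excludes `u (m + 1)`, so `s = u m`. -/
theorem exists_adj_left (K : Config D G low b C) (k : D.Link G low (allVerts b C) x y)
    (hs : s ∈ D.lab G low x) (hsX : s ∈ allVerts b C) :
    ∃ a, D.h x ≤ 2 * a ∧ 2 * a ≤ D.h y ∧ 2 * a ≤ D.h x + 1 ∧ G.Adj s (D.u a) := by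
  have L := K.ladder
  have hlt := K.h_lt k
  have lx := k.left.labelled
  obtain ⟨m, hm | hm⟩ := Int.even_or_odd' (D.h x)
  · refine ⟨m, by omega, by omega, by omega, ?_⟩
    rcases L.lab_even x m lx hm s hs with rfl | h
    · exact absurd hsX (K.not_mem k (by omega) (by omega))
    · exact h.2.1.symm
  · refine ⟨m + 1, by omega, by omega, by omega, ?_⟩
    have hr := L.h_range x lx
    have hr' := L.h_range y k.right.labelled
    rcases (L.lab_odd x m lx hm s).1 hs with rfl | rfl
    · exact (L.u_adj _ _ ⟨by omega, by omega⟩ ⟨by omega, by omega⟩).2 (.inl rfl)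
    · exact absurd hsX (K.not_mem k (by omega) (by omega))

theorem exists_adj_right (K : Config D G low b C) (k : D.Link G low (allVerts b C) x y)
    (hs : s ∈ D.lab G low y) (hsX : s ∈ allVerts b C) :
    ∃ a, D.h x ≤ 2 * a ∧ 2 * a ≤ D.h y ∧ D.h y - 1 ≤ 2 * a ∧ G.Adj s (D.u a) := by
  obtain ⟨a, h1, h2, h3, h4⟩ := K.rev.exists_adj_left (s := s) k.rev
    (by rwa [rev_lab, neg_neg]) hsX
  simp only [Strip.rev, neg_neg] at h1 h2 h3 h4
  exact ⟨-a, by omega, by omega, by omega, h4⟩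

/-- An ancestor in the configuration of an end of a link is adjacent to a vertex below the link. -/
theorem exists_adj_end (K : Config D G low b C) (k : D.Link G low (allVerts b C) x y)
    (hp : p = x ∨ p = y) (hs : s ∈ D.lab G low p) (hsX : s ∈ allVerts b C) :
    ∃ a, D.h x ≤ 2 * a ∧ 2 * a ≤ D.h y ∧ D.h p - 1 ≤ 2 * a ∧ 2 * a ≤ D.h p + 1 ∧
      G.Adj s (D.u a) := by
  rcases hp with rfl | rfl
  · obtain ⟨a, h1, h2, h3, h4⟩ := K.exists_adj_left k hs hsX
    exact ⟨a, h1, h2, by omega, h3, h4⟩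
  · obtain ⟨a, h1, h2, h3, h4⟩ := K.exists_adj_right k hs hsX
    exact ⟨a, h1, h2, h3, by omega, h4⟩

theorem reach_below (K : Config D G low b C) (k : D.Link G low (allVerts b C) x y) {i : ℤ}
    (h1 : D.h x ≤ 2 * i) (h2 : 2 * i ≤ D.h y) (h3 : D.h x ≤ 2 * j) (h4 : 2 * j ≤ D.h y) :
    ReachIn G (D.below G low (allVerts b C)) (D.u i) (D.u j) := by
  have key : ∀ (n : ℕ) (i : ℤ), D.h x ≤ 2 * i → 2 * (i + n) ≤ D.h y →
      ReachIn G (D.below G low (allVerts b C)) (D.u i) (D.u (i + n)) := by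
    intro n
    induction n with
    | zero => intro i _ _; simpa using Relation.ReflTransGen.refl
    | succ n ih =>
      intro i h1 h2
      push_cast at h2 ⊢
      refine (ih i h1 (by omega)).tail ⟨?_, ?_, ?_⟩
      · exact ⟨x, y, _, k, by omega, by omega, rfl⟩
      · exact ⟨x, y, _, k, by omega, by omega, rfl⟩
      · exact (K.ladder.u_adj _ _ (K.ladder.J_of_between k.toGap (by omega) (by omega))
          (K.ladder.J_of_between k.toGap (by omega) (by omega))).2 (.inl (by ring))
  rcases le_total i j with h | h
  · obtain ⟨n, rfl⟩ := Int.le.dest h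
    exact key n i h1 h4
  · obtain ⟨n, rfl⟩ := Int.le.dest h
    exact (key n j h3 h2).symm

/-- Replacing the links by the vertices below them preserves connectivity. -/
theorem conn_lower (K : Config D G low b C) {E : Set V} (hE : ConnIn G E)
    (hEX : E ⊆ allVerts b C) (hEt : ∀ p, D.I p → D.t p ∈ allVerts b C → D.t p ∈ E) :
    ConnIn G ((E ∩ low) ∪ D.below G low (allVerts b C)) := by
  have L := K.ladder
  set F := (E ∩ low) ∪ D.below G low (allVerts b C) with hF
  have hbF : D.below G low (allVerts b C) ⊆ F := Set.subset_union_right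
  -- This invariant follows a walk in `E` by a walk in `F`: a low vertex is reached itself, and
  -- inside a link every vertex below that link is reached.
  let Inv : V → V → Prop := fun e z => (z ∈ low → ReachIn G F e z) ∧
    ∀ x y p j, D.Link G low (allVerts b C) x y → x ≤ p → p ≤ y → z = D.t p →
      D.h x ≤ 2 * j → 2 * j ≤ D.h y → ReachIn G F e (D.u j)
  have step : ∀ e z w, StepIn G E z w → Inv e z → Inv e w := by
    rintro e z w ⟨hz, hw, hadj⟩ ⟨hi1, hi2⟩
    constructor
    · intro hwl
      rcases K.cover z (hEX hz) with hzl | ⟨p, hp, rfl⟩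
      · exact (hi1 hzl).tail ⟨.inl ⟨hz, hzl⟩, .inl ⟨hw, hwl⟩, hadj⟩
      · obtain ⟨x, y, k, hk⟩ := K.exists_link_of_hit (hEX hz) ⟨hp, w, ⟨hwl, hadj⟩, hEX hw⟩
        obtain ⟨a, h1, h2, -, -, h3⟩ := K.exists_adj_end k hk ⟨hwl, hadj⟩ (hEX hw)
        have := k.lt
        exact (hi2 x y p a k (by omega) (by omega) rfl h1 h2).tail
          ⟨hbF ⟨x, y, a, k, h1, h2, rfl⟩, .inl ⟨hw, hwl⟩, h3.symm⟩
    · rintro x y p j k hxp hpy rfl hj1 hj2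
      have hpI := k.I_mem hxp hpy
      rcases K.cover z (hEX hz) with hzl | ⟨q, hq, rfl⟩
      · have hlab : z ∈ D.lab G low p := ⟨hzl, hadj.symm⟩
        obtain ⟨a, h1, h2, -, -, h3⟩ := K.exists_adj_end k
          (k.eq_of_hit hxp hpy ⟨hpI, z, hlab, hEX hz⟩) hlab (hEX hz)
        exact ((hi1 hzl).tail ⟨.inl ⟨hz, hzl⟩, hbF ⟨x, y, a, k, h1, h2, rfl⟩, h3⟩).trans
          ((K.reach_below k h1 h2 hj1 hj2).mono hbF)
      · rw [L.t_adj _ _ hq hpI] at hadj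
        refine hi2 x y q j k ?_ ?_ rfl hj1 hj2
        · by_contra hlt
          obtain rfl : q = x - 1 := by omega
          exact k.left_max hq (hEX hz)
        · by_contra hlt
          obtain rfl : q = y + 1 := by omega
          exact k.right_max hq (hEX hz)
  have start : ∀ e ∈ F, ∃ d ∈ E, Inv e d := by
    rintro e (⟨he, hel⟩ | ⟨x, y, j, k, h1, h2, rfl⟩)
    · refine ⟨e, he, fun _ => .refl, ?_⟩
      rintro x y p j k hxp hpy rfl
      exact absurd hel (L.t_not_low _ (k.I_mem hxp hpy))
    · refine ⟨D.t x, hEt x k.left.1 (k.mem x le_rfl k.lt.le), fun h => ?_, ?_⟩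
      · exact absurd h (L.t_not_low _ k.left.1)
      · intro x' y' p i k' hxp hpy hp h3 h4
        obtain rfl := L.t_inj _ _ k.left.1 (k'.I_mem hxp hpy) hp
        obtain ⟨rfl, rfl⟩ := k.eq k' le_rfl k.lt.le hxp hpy
        exact (K.reach_below k h1 h2 h3 h4).mono hbF
  have walk : ∀ e z w, ReachIn G E z w → Inv e z → Inv e w := by
    intro e z w h hz
    induction h with
    | refl => exact hz
    | tail _ h ih => exact step _ _ _ h ih
  intro e he f hf
  obtain ⟨d, hd, hinv⟩ := start e he
  rcases hf with ⟨hfE, hfl⟩ | ⟨x, y, j, k, h1, h2, rfl⟩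
  · exact (walk e d f (hE d hd f hfE) hinv).1 hfl
  · exact (walk e d (D.t x) (hE d hd _ (hEt x k.left.1 (k.mem x le_rfl k.lt.le))) hinv).2
      x y x j k le_rfl k.lt.le rfl h1 h2

variable {c c' : V} {i i' : Fin 3}

/-- A vertex of the lowered configuration adjacent to `b i` corresponds to a vertex of `C`. -/
theorem exists_rep_of_adj (K : Config D G low b C) (hi : b i ∈ low)
    (hc : c ∈ (C ∩ low) ∪ D.below G low (allVerts b C)) (hadj : G.Adj (b i) c)
    (hC : ∀ p, D.I p → D.t p ∈ allVerts b C → D.t p ∉ C →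
      ∃ m, D.h p = 2 * m ∧ b i ∈ D.anc G low m ∧ c ≠ D.u m) :
    (c ∈ C ∧ c ∈ low) ∨
      ∃ j p, c = D.u j ∧ D.I p ∧ D.t p ∈ C ∧ D.J j ∧ D.Represents G low (b i) j p := by
  rcases hc with hc | ⟨x, y, j, k, h1, h2, rfl⟩
  · exact .inl hc
  · obtain ⟨p, hp, hpX, hrep⟩ := K.exists_represents k h1 h2 hi (b_mem i) hadj
    refine .inr ⟨j, p, rfl, hp, ?_, K.ladder.J_of_between k.toGap h1 h2, hrep⟩
    by_contra hpC
    obtain ⟨m, hm1, hm2, hm3⟩ := hC p hp hpX hpC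
    rcases hrep.2 with ⟨-, h, -⟩ | ⟨hJ, h, -⟩ | ⟨hJ, h, -⟩
    · obtain rfl : j = m := by omega
      exact hm3 rfl
    · exact hm2.2.2 _ hJ h
    · exact hm2.2.2 _ hJ h

/-- Each neighbour of `b i` in the lowered set is a vertex of `C` or is represented by a neighbour
`t p` of `b i` in `C`, so uniqueness is inherited. The last hypothesis rules out representation by a
triangle vertex in the upper layer. -/
theorem uniq_lower (K : Config D G low b C) (hi : b i ∈ low)
    (hc : c ∈ (C ∩ low) ∪ D.below G low (allVerts b C)) (hadj : G.Adj (b i) c)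
    (hc' : c' ∈ (C ∩ low) ∪ D.below G low (allVerts b C)) (hadj' : G.Adj (b i) c')
    (hC : ∀ p, D.I p → D.t p ∈ allVerts b C → D.t p ∉ C →
      ∃ m, D.h p = 2 * m ∧ b i ∈ D.anc G low m ∧ c ≠ D.u m ∧ c' ≠ D.u m) : c = c' := by
  have L := K.ladder
  have r1 := K.exists_rep_of_adj hi hc hadj fun p h1 h2 h3 =>
    (hC p h1 h2 h3).imp fun m h => ⟨h.1, h.2.1, h.2.2.1⟩
  have r2 := K.exists_rep_of_adj hi hc' hadj' fun p h1 h2 h3 =>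
    (hC p h1 h2 h3).imp fun m h => ⟨h.1, h.2.1, h.2.2.2⟩
  rcases r1 with ⟨h1, h2⟩ | ⟨j, p, rfl, hp, hpC, hj, hr⟩ <;>
    rcases r2 with ⟨h1', h2'⟩ | ⟨j', p', rfl, hp', hpC', hj', hr'⟩
  · exact K.att.uniq i _ h1 _ h1' hadj hadj'
  · obtain rfl := K.att.uniq i _ h1 _ hpC' hadj hr'.1.2.symm
    exact absurd h2 (L.t_not_low _ hp')
  · obtain rfl := K.att.uniq i _ h1' _ hpC hadj' hr.1.2.symm
    exact absurd h2' (L.t_not_low _ hp)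
  · obtain rfl := L.t_inj _ _ hp hp' (K.att.uniq i _ hpC _ hpC' hr.1.2.symm hr'.1.2.symm)
    -- The height of `p` determines `j`, except that `p` may lie between `u j` and `u j'`; then `b
    -- i` would be both of these vertices.
    have : j = j' := by
      rcases hr.2 with ⟨a1, a2, -⟩ | ⟨a1, a2, a3⟩ | ⟨a1, a2, a3⟩ <;>
        rcases hr'.2 with ⟨b1, b2, -⟩ | ⟨b1, b2, b3⟩ | ⟨b1, b2, b3⟩
      any_goals omega
      · have := L.u_inj _ _ a1 b1 (a2.symm.trans b2); omega
      · have := L.u_inj _ _ a1 b1 (a2.symm.trans b2); omega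
    rw [this]

/-- If both triangle vertices are ancestors of `u j`, the representing vertex sees both, against
`sep`. If one is an ancestor and the other is a neighbour of `u j` in its layer, the triangle edge
gives two consecutive vertices with ancestors. Two neighbours in the layer are equal or nonadjacent.
-/
theorem sep_lower (K : Config D G low b C) (hi : b i ∈ low) (hi' : b i' ∈ low)
    (hc : c ∈ (C ∩ low) ∪ D.below G low (allVerts b C)) (hadj : G.Adj (b i) c)
    (hadj' : G.Adj (b i') c)
    (hC : ∀ p, D.I p → D.t p ∈ allVerts b C → D.t p ∉ C →
      ∃ m, D.h p = 2 * m ∧ b i ∈ D.anc G low m ∧ b i' ∈ D.anc G low m ∧ c ≠ D.u m) : i = i' := by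
  have L := K.ladder
  have r1 := K.exists_rep_of_adj hi hc hadj fun p h1 h2 h3 =>
    (hC p h1 h2 h3).imp fun m h => ⟨h.1, h.2.1, h.2.2.2⟩
  rcases r1 with ⟨h1, h2⟩ | ⟨j, p, rfl, hp, hpC, hj, hr⟩
  · exact K.att.sep _ _ _ h1 hadj hadj'
  by_contra hne
  have htri := K.att.tri i i' hne
  have space : ∀ {j' : ℤ} {s s' : V}, D.J j' → s ∈ D.anc G low j → s' = D.u j' → G.Adj s s' →
      (j' = j + 1 ∨ j' = j - 1) → False := by
    rintro j' s s' hj' hs rfl h hjj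
    have hs' : s ∈ D.anc G low j' := ⟨hs.1, h.symm, hs.2.2⟩
    rcases hjj with rfl | rfl
    · exact L.u_space _ _ hj hj' ⟨s, hs⟩ ⟨s, hs'⟩ rfl
    · exact L.u_space _ _ hj' hj ⟨s, hs'⟩ ⟨s, hs⟩ (by ring)
  rcases hr.2 with ⟨a1, a2, a3⟩ | ⟨a1, a2, -⟩ | ⟨a1, a2, -⟩ <;>
    rcases L.low_nbr hj hi' hadj'.symm with b1 | ⟨b1, b2⟩ | ⟨b1, b2⟩
  · exact hne (K.att.sep _ _ _ hpC hr.1.2.symm (a3 b1).2.symm)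
  · exact space b1 a1 b2 htri (.inl rfl)
  · exact space b1 a1 b2 htri (.inr rfl)
  · exact space a1 b1 a2 htri.symm (.inl rfl)
  · exact hne (K.b_inj (a2.trans b2.symm))
  · rw [a2, b2, L.u_adj _ _ a1 b1] at htri; omega
  · exact space a1 b1 a2 htri.symm (.inr rfl)
  · rw [a2, b2, L.u_adj _ _ a1 b1] at htri; omega
  · exact hne (K.b_inj (a2.trans b2.symm))

/-- If the triangle lies in the lower layers, the configuration can be lowered. -/
theorem attached_of_low (K : Config D G low b C) (hb : ∀ i, b i ∈ low) :
    Attached G b ((C ∩ low) ∪ D.below G low (allVerts b C)) := by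
  have L := K.ladder
  have hC : ∀ p, D.I p → D.t p ∈ allVerts b C → D.t p ∈ C := by
    rintro p hp (h | ⟨i, hi⟩)
    · exact h
    · exact absurd (hi ▸ hb i) (L.t_not_low _ hp)
  refine ⟨K.att.tri, ?_, ?_, ?_, ?_, ?_⟩
  · rintro i (h | h)
    · exact K.att.disj i h.1
    · exact K.below_disjoint h (b_mem i)
  · exact K.conn_lower K.att.conn Set.subset_union_left hC
  · intro i
    obtain ⟨c, hc, hic⟩ := K.att.nbr i
    rcases K.cover c (.inl hc) with hl | ⟨p, hp, rfl⟩
    · exact ⟨c, .inl ⟨hc, hl⟩, hic⟩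
    · have hlab : b i ∈ D.lab G low p := ⟨hb i, hic.symm⟩
      obtain ⟨x, y, k, hk⟩ := K.exists_link_of_hit (.inl hc) ⟨hp, _, hlab, b_mem i⟩
      obtain ⟨a, h1, h2, -, -, h3⟩ := K.exists_adj_end k hk hlab (b_mem i)
      exact ⟨D.u a, .inr ⟨x, y, a, k, h1, h2, rfl⟩, h3⟩
  · exact fun i c hc c' hc' h h' => K.uniq_lower (hb i) hc h hc' h' fun p h1 h2 h3 =>
      absurd (hC p h1 h2) h3
  · exact fun i i' c hc h h' => K.sep_lower (hb i) (hb i') hc h h' fun p h1 h2 h3 =>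
      absurd (hC p h1 h2) h3

end Config

theorem ConnIn.insert_vertex {C : Set V} (hC : ConnIn G C) {b c : V} (hc : c ∈ C) (h : G.Adj b c) :
    ConnIn G (insert b C) := by
  have key : ∀ x ∈ insert b C, ReachIn G (insert b C) c x := by
    rintro x (rfl | hx)
    · exact ReachIn.single (.inr hc) (.inl rfl) h.symm
    · exact (hC c hc x hx).mono (Set.subset_insert _ _)
  exact fun x hx y hy => (key x hx).symm.trans (key y hy)

/-! ### Lowering when a triangle vertex is in the upper layer. -/

namespace Config

open Strip

variable {D : Strip V} {low : Set V} {b : Fin 3 → V} {C : Set V} {x y m : ℤ} {i₀ : Fin 3}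

/-- The other two triangle vertices are ancestors of `t x`, and vertices below the link are
excluded. At odd height only one candidate would be left for both. -/
theorem exists_even_of_b_left (K : Config D G low b C) (k : D.Link G low (allVerts b C) x y)
    (hi₀ : b i₀ = D.t x) :
    ∃ m, D.h x = 2 * m ∧ ∀ i, i ≠ i₀ → b i ∈ D.anc G low m := by
  have L := K.ladder
  have hlt := K.h_lt k
  have lx := k.left.labelled
  have hlow : ∀ i, i ≠ i₀ → b i ∈ D.lab G low x := fun i hi =>
    ⟨K.b_low k.left.1 hi₀ hi.symm, hi₀ ▸ K.att.tri _ _ hi.symm⟩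
  obtain ⟨m, hm | hm⟩ := Int.even_or_odd' (D.h x)
  · refine ⟨m, hm, fun i hi => ?_⟩
    refine (L.lab_even x m lx hm _ (hlow i hi)).resolve_left fun h => ?_
    exact K.not_mem k (j := m) (by omega) (by omega) (h ▸ b_mem i)
  · exfalso
    have key : ∀ i, i ≠ i₀ → b i = D.u m := by
      intro i hi
      refine ((L.lab_odd x m lx hm _).1 (hlow i hi)).resolve_right fun h => ?_
      exact K.not_mem k (j := m + 1) (by omega) (by omega) (h ▸ b_mem i)
    obtain ⟨j, hj, -⟩ := exists_third i₀ i₀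
    obtain ⟨k, hk, hkj⟩ := exists_third i₀ j
    exact hkj (K.b_inj ((key k hk).trans (key j hj).symm))

/-- The vertex below a link that starts in the triangle is not below another link on the left. -/
theorem right_ne_of_b_left (K : Config D G low b C) (k : D.Link G low (allVerts b C) x y)
    (hi₀ : b i₀ = D.t x) (hm : D.h x = 2 * m) (hanc : ∀ i, i ≠ i₀ → b i ∈ D.anc G low m)
    {x' y' : ℤ} (k' : D.Link G low (allVerts b C) x' y') : D.h y' ≠ 2 * m := by
  intro hy'
  have L := K.ladder
  have hu := K.not_mem k (j := m) hm.le (by have := K.h_lt k; omega)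
  have hJ : D.J m := L.J_of_between k.toGap hm.le (by have := K.h_lt k; omega)
  obtain ⟨j, hj, -⟩ := exists_third i₀ i₀
  obtain ⟨i, hi, hij⟩ := exists_third i₀ j
  -- The first position above `u m` seeing all its ancestors sees two triangle vertices, so it
  -- cannot be in `C`; earlier own positions see only `u m` and are not hits.
  obtain ⟨p, hp1, hp2, hp3, hp4⟩ := L.anc_first m hJ ⟨_, hanc j hj⟩
  have hp : D.Hit G low (allVerts b C) p := ⟨hp1.1, _, hp3 (hanc j hj), b_mem j⟩
  have hxp := L.lt_of_h_lt k'.left.labelled hp1 (by have := K.h_lt k'; omega)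
  have hyp : y' ≤ p := by
    by_contra h
    exact k'.inner p hxp (by omega) hp
  rcases hyp.eq_or_lt with rfl | hyp
  · rcases k'.mem y' k'.lt.le le_rfl with hC | ⟨i', hi'⟩
    · exact hij (K.att.sep _ _ _ hC (hp3 (hanc i hi)).2.symm (hp3 (hanc j hj)).2.symm)
    · by_cases hii : i' = i₀
      · subst hii
        obtain rfl := L.t_inj _ _ k.left.1 hp1.1 (hi₀.symm.trans hi')
        have := k'.lt
        have := (k.eq k' le_rfl k.lt.le this.le le_rfl).1
        omega
      · exact L.t_not_low _ hp1.1 (hi' ▸ (hanc i' hii).1)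
  · obtain ⟨-, s, hs, hsX⟩ := k'.right
    exact hu (hp4 y' k'.right.labelled hy' hyp s hs ▸ hsX)

/-- In the lowered configuration, the vertex replacing the triangle vertex at the left end of a link
can only be adjacent to its right neighbour. -/
theorem eq_of_adj_replaced (K : Config D G low b C) (k : D.Link G low (allVerts b C) x y)
    (hi₀ : b i₀ = D.t x) (hm : D.h x = 2 * m) (hanc : ∀ i, i ≠ i₀ → b i ∈ D.anc G low m) {c : V}
    (hc : c ∈ (C ∩ low) ∪ D.below G low (allVerts b C)) (hadj : G.Adj (D.u m) c) :
    D.J (m + 1) ∧ c = D.u (m + 1) := by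
  have L := K.ladder
  have hlt := K.h_lt k
  have hu := K.not_mem k (j := m) hm.le (by omega)
  have hJ : D.J m := L.J_of_between k.toGap hm.le (by omega)
  obtain ⟨j, hj, -⟩ := exists_third i₀ i₀
  obtain ⟨i, hi, hij⟩ := exists_third i₀ j
  have hcl : c ∈ low := hc.elim (fun h => h.2) K.below_low
  -- A link coming from the left may not stop at height `2 * m`, and beyond it the hit `x` would be
  -- interior.
  have hpass : ∀ {x' y' : ℤ}, D.Link G low (allVerts b C) x' y' → D.h x' < 2 * m →
      D.h y' ≤ 2 * m - 1 := by
    intro x' y' k' h'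
    have h1 := K.right_ne_of_b_left k hi₀ hm hanc k'
    by_contra h2
    exact k'.inner x (L.lt_of_h_lt k'.left.labelled k.left.labelled (by omega))
      (L.lt_of_h_lt k.left.labelled k'.right.labelled (by omega)) k.left
  rcases L.low_nbr hJ hcl hadj with h | h | ⟨hJ', rfl⟩
  · exfalso
    rcases hc with ⟨hcC, -⟩ | ⟨x', y', j', k', h1, h2, rfl⟩
    · have a1 := L.anc_clique m hJ _ (hanc i hi) _ h (K.c_ne_b hcC i).symm
      have a2 := L.anc_clique m hJ _ (hanc j hj) _ h (K.c_ne_b hcC j).symm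
      exact hij (K.att.sep _ _ _ hcC a1 a2)
    · exact h.2.2 j' (L.J_of_between k'.toGap h1 h2) rfl
  · exact h
  · exfalso
    rcases hc with ⟨hcC, -⟩ | hbel
    · obtain ⟨x', y', k', h'⟩ := K.exists_link_left k hm.le (by omega) hJ' (.inl hcC)
      have := K.h_lt k'
      have := hpass k' (by omega)
      omega
    · have hu' := K.below_disjoint hbel
      obtain ⟨x', y', j', k', h1, h2, he⟩ := hbel
      obtain rfl := L.u_inj _ _ hJ' (L.J_of_between k'.toGap h1 h2) he
      have h3 := hpass k' (by omega)
      have ly := k'.right.labelled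
      obtain ⟨-, s, hs, hsX⟩ := k'.right
      by_cases h4 : D.h y' = 2 * (m - 1)
      · rcases L.lab_even y' _ ly h4 s hs with rfl | hs'
        · exact hu' hsX
        · exact L.u_space _ _ hJ' hJ ⟨s, hs'⟩ ⟨_, hanc j hj⟩ (by ring)
      · rcases (L.lab_odd y' (m - 1) ly (by omega) s).1 hs with rfl | rfl
        · exact hu' hsX
        · rw [sub_add_cancel] at hsX
          exact hu hsX

/-- If a vertex of the triangle is the left end of a link, the configuration can be lowered. -/
theorem exists_attached_of_b_left (K : Config D G low b C)
    (k : D.Link G low (allVerts b C) x y) (hi₀ : b i₀ = D.t x) :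
    ∃ b' C', Attached G b' C' ∧ (∀ i, b' i ∈ low) ∧ C' ⊆ low := by
  have L := K.ladder
  have hlt := K.h_lt k
  obtain ⟨m, hm, hanc⟩ := K.exists_even_of_b_left k hi₀
  have hu := K.not_mem k (j := m) hm.le (by omega)
  have hJ : D.J m := L.J_of_between k.toGap hm.le (by omega)
  have hlow : ∀ i, i ≠ i₀ → b i ∈ low := fun i hi => (hanc i hi).1
  have hi₀low : b i₀ ∉ low := hi₀ ▸ L.t_not_low _ k.left.1
  set F := (C ∩ low) ∪ D.below G low (allVerts b C) with hF
  have hnbr : ∀ c ∈ F, G.Adj (D.u m) c → D.J (m + 1) ∧ c = D.u (m + 1) := fun c hc h =>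
    K.eq_of_adj_replaced k hi₀ hm hanc hc h
  -- If the link ends at height `2 * m + 1`, its right end is attached to `u (m + 1)`, which is then
  -- in `C`; otherwise `u (m + 1)` is below the link.
  have hex : D.u (m + 1) ∈ F \ {D.u m} ∧ G.Adj (D.u m) (D.u (m + 1)) := by
    have hr := L.h_range y k.right.labelled
    have hJ' : D.J (m + 1) := ⟨by have := hJ.1; omega, by omega⟩
    refine ⟨⟨?_, fun h => ?_⟩, (L.u_adj _ _ hJ hJ').2 (.inl rfl)⟩
    · rcases (show D.h y = 2 * m + 1 ∨ 2 * (m + 1) ≤ D.h y by omega) with hy | hy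
      · have ly := k.right.labelled
        obtain ⟨-, s, hs, hsX⟩ := k.right
        rcases (L.lab_odd y m ly hy s).1 hs with rfl | rfl
        · exact absurd hsX hu
        · refine .inl ⟨hsX.resolve_right ?_, hs.1⟩
          rintro ⟨i, hi⟩
          by_cases hii : i = i₀
          · exact hi₀low (by rw [← hii, hi]; exact hs.1)
          · exact (hanc i hii).2.2 _ hJ' hi
      · exact .inr ⟨x, y, m + 1, k, by omega, hy, rfl⟩
    · have := L.u_inj _ _ hJ' hJ h; omega
  have hC : ∀ p, D.I p → D.t p ∈ allVerts b C → D.t p ∉ C → p = x := by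
    rintro p hp (h | ⟨i, hi⟩) hpC
    · exact absurd h hpC
    · by_cases hii : i = i₀
      · exact L.t_inj _ _ hp k.left.1 (by rw [← hi₀, ← hi, hii])
      · exact absurd (hi ▸ hlow i hii) (L.t_not_low _ hp)
  -- The set that is lowered must contain the whole upper part, so `b i₀` is first added to `C`; it
  -- disappears again on intersecting with `low`.
  have hconn : ConnIn G F := by
    obtain ⟨c, hc, hic⟩ := K.att.nbr i₀
    have := K.conn_lower (K.att.conn.insert_vertex hc hic)
      (Set.insert_subset (b_mem i₀) Set.subset_union_left) fun p hp hX => by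
        by_cases hpC : D.t p ∈ C
        · exact .inr hpC
        · rw [hC p hp hX hpC, ← hi₀]; exact .inl rfl
    rwa [Set.insert_inter_of_notMem hi₀low] at this
  refine ⟨Function.update b i₀ (D.u m), F \ {D.u m}, ⟨?_, ?_, ?_, ?_, ?_, ?_⟩, ?_, ?_⟩
  · intro i j hij
    by_cases h1 : i = i₀
    · subst h1
      rw [Function.update_self, Function.update_of_ne hij.symm]
      exact (hanc j hij.symm).2.1
    · by_cases h2 : j = i₀
      · subst h2
        rw [Function.update_self, Function.update_of_ne hij]
        exact (hanc i hij).2.1.symm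
      · rw [Function.update_of_ne h1, Function.update_of_ne h2]
        exact K.att.tri i j hij
  · intro i
    by_cases h1 : i = i₀
    · subst h1
      rw [Function.update_self]
      exact fun h => h.2 rfl
    · rw [Function.update_of_ne h1]
      rintro ⟨h | h, -⟩
      · exact K.att.disj i h.1
      · exact K.below_disjoint h (b_mem i)
  · refine hconn.diff ?_
    rintro d rfl d' rfl n hn n' hn' h h'
    rw [(hnbr n hn.1 h.symm).2, (hnbr n' hn'.1 h'.symm).2]
  · intro i
    by_cases h1 : i = i₀
    · subst h1
      rw [Function.update_self]
      exact ⟨_, hex⟩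
    · rw [Function.update_of_ne h1]
      obtain ⟨c, hc, hic⟩ := K.att.nbr i
      rcases K.cover c (.inl hc) with hl | ⟨p, hp, rfl⟩
      · refine ⟨c, ⟨.inl ⟨hc, hl⟩, ?_⟩, hic⟩
        rintro rfl
        exact hu (.inl hc)
      · have hlab : b i ∈ D.lab G low p := ⟨hlow i h1, hic.symm⟩
        have hhit : D.Hit G low (allVerts b C) p := ⟨hp, _, hlab, b_mem i⟩
        obtain ⟨x', y', k', hk⟩ := K.exists_link_of_hit (.inl hc) hhit
        obtain ⟨a, h2, h3, h4, h5, h6⟩ := K.exists_adj_end k' hk hlab (b_mem i)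
        -- The neighbour must differ from `u m`, the new triangle vertex. Equality would put `p` at
        -- height `2 * m`: as a left end it would be `x`, which is not in `C`, and no right end has
        -- this height.
        refine ⟨D.u a, ⟨.inr ⟨x', y', a, k', h2, h3, rfl⟩, fun he => ?_⟩, h6⟩
        obtain rfl := L.u_inj _ _ (L.J_of_between k'.toGap h2 h3) hJ he
        have hr := L.h_range p hhit.labelled
        have hpa : D.h p = 2 * a := by
          obtain ⟨n, hn | hn⟩ := Int.even_or_odd' (D.h p)
          · omega
          · rcases (L.lab_odd p n hhit.labelled hn _).1 hlab with h | h
            · exact absurd h ((hanc i h1).2.2 _ ⟨by omega, by omega⟩)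
            · exact absurd h ((hanc i h1).2.2 _ ⟨by omega, by omega⟩)
        rcases hk with rfl | rfl
        · have := K.left_unique k k' (hm.trans hpa.symm)
          rw [← this, ← hi₀] at hc
          exact K.att.disj i₀ hc
        · exact K.right_ne_of_b_left k hi₀ hm hanc k' hpa
  · intro i c hc c' hc' h h'
    by_cases h1 : i = i₀
    · subst h1
      rw [Function.update_self] at h h'
      rw [(hnbr c hc.1 h).2, (hnbr c' hc'.1 h').2]
    · rw [Function.update_of_ne h1] at h h'
      refine K.uniq_lower (hlow i h1) hc.1 h hc'.1 h' fun p hp hX hpC => ?_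
      obtain rfl := hC p hp hX hpC
      exact ⟨m, hm, hanc i h1, hc.2, hc'.2⟩
  · intro i j c hc h h'
    -- The only neighbour of `u m` is `u (m + 1)`, which has no ancestors because `u m` has some.
    have key : ∀ i, i ≠ i₀ → G.Adj (D.u m) c → ¬ G.Adj (b i) c := by
      intro i hi hadj h
      obtain ⟨hJ', rfl⟩ := hnbr c hc.1 hadj
      exact L.u_space _ _ hJ hJ' ⟨_, hanc i hi⟩
        ⟨_, (hanc i hi).1, h.symm, (hanc i hi).2.2⟩ rfl
    by_cases h1 : i = i₀ <;> by_cases h2 : j = i₀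
    · rw [h1, h2]
    · subst h1
      rw [Function.update_self] at h
      rw [Function.update_of_ne h2] at h'
      exact absurd h' (key j h2 h)
    · subst h2
      rw [Function.update_self] at h'
      rw [Function.update_of_ne h1] at h
      exact absurd h (key i h1 h')
    · rw [Function.update_of_ne h1] at h
      rw [Function.update_of_ne h2] at h'
      refine K.sep_lower (hlow i h1) (hlow j h2) hc.1 h h' fun p hp hX hpC => ?_
      obtain rfl := hC p hp hX hpC
      exact ⟨m, hm, hanc i h1, hanc j h2, hc.2⟩
  · intro i
    by_cases h1 : i = i₀
    · subst h1
      rw [Function.update_self]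
      exact L.u_low _ hJ
    · rw [Function.update_of_ne h1]
      exact hlow i h1
  · rintro c ⟨h | h, -⟩
    · exact h.2
    · exact K.below_low h

/-- A minimal obstruction can be lowered. -/
theorem exists_attached_low (K : Config D G low b C) :
    ∃ b' C', Attached G b' C' ∧ (∀ i, b' i ∈ low) ∧ C' ⊆ low := by
  by_cases hb : ∀ i, b i ∈ low
  · refine ⟨b, _, K.attached_of_low hb, hb, ?_⟩
    rintro c (h | h)
    · exact h.2
    · exact K.below_low h
  · push Not at hb
    obtain ⟨i, hi⟩ := hb
    obtain ⟨p, hp, hip⟩ := (K.cover _ (b_mem i)).resolve_left hi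
    obtain ⟨x, y, k, rfl | rfl⟩ := K.exists_link_of_hit (hip ▸ b_mem i) (K.hit_of_b hp hip)
    · exact K.exists_attached_of_b_left k hip
    · exact K.rev.exists_attached_of_b_left k.rev
        (by simpa only [Strip.rev, neg_neg] using hip)

end Config

/-- Finiteness of `C` allows a choice of least cardinality, which is then inclusion-minimal. -/
theorem exists_attached_low {D : Strip V} {low : Set V} (L : D.IsLadder G low) {b : Fin 3 → V}
    {C : Set V} (h : Attached G b C) (hfin : C.Finite)
    (hcov : ∀ x ∈ allVerts b C, x ∈ low ∨ ∃ p, D.I p ∧ x = D.t p) :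
    ∃ b' C', Attached G b' C' ∧ (∀ i, b' i ∈ low) ∧ C' ⊆ low := by
  obtain ⟨C₀, ⟨hle, h₀⟩, hmin⟩ := WellFounded.has_min (r := fun A B : Set V => A.ncard < B.ncard)
    (measure Set.ncard).wf {A | A ⊆ C ∧ Attached G b A} ⟨C, subset_rfl, h⟩
  refine Config.exists_attached_low (D := D) (b := b) (C := C₀) ⟨L, h₀, fun C' hC' hatt => ?_, ?_⟩
  · exact hmin C' ⟨hC'.subset.trans hle, hatt⟩ (Set.ncard_lt_ncard hC' (hfin.subset hle))
  · exact fun x hx => hcov x (hx.imp (fun h => hle h) id)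

/-! ### Ancestor lists and heights read off from the zones. -/

/-- The elements of a filtered list correspond to positions of the original list. -/
theorem exists_filter_index {α : Type*} (c : α → Bool) (N : List α) :
    ∃ g : ℕ → ℕ, (∀ p B, N[p]? = some B → c B → (N.filter c)[g p]? = some B) ∧
      (∀ p q B B', N[p]? = some B → c B → N[q]? = some B' → c B' → p < q → g p < g q) ∧
      ∀ a B, (N.filter c)[a]? = some B → ∃ p, N[p]? = some B ∧ c B ∧ g p = a := by
  induction N with
  | nil => exact ⟨id, by simp, by simp, by simp⟩
  | cons x N ih =>
    obtain ⟨g, h1, h2, h3⟩ := ih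
    by_cases hx : c x
    · refine ⟨fun p => p.casesOn 0 fun p => g p + 1, ?_, ?_, ?_⟩
      · rintro (_ | p) B hB hc
        · simpa [List.filter_cons, hx] using hB
        · simpa [List.filter_cons, hx] using h1 p B (by simpa using hB) hc
      · rintro (_ | p) (_ | q) B B' hB hc hB' hc' hlt
        · simp at hlt
        · simp
        · simp at hlt
        · simpa using h2 p q B B' (by simpa using hB) hc (by simpa using hB') hc' (by omega)
      · rintro (_ | a) B hB
        · simp only [List.filter_cons, hx, if_true, List.getElem?_cons_zero, Option.some.injEq] at hB
          subst hB
          exact ⟨0, by simp, hx, rfl⟩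
        · simp only [List.filter_cons, hx, if_true, List.getElem?_cons_succ] at hB
          obtain ⟨p, h4, h5, h6⟩ := h3 a B hB
          exact ⟨p + 1, by simpa using h4, h5, by simp [h6]⟩
    -- The value at position 0 is irrelevant, since the head is discarded.
    · refine ⟨fun p => g (p - 1), ?_, ?_, ?_⟩
      · rintro (_ | p) B hB hc
        · simp at hB
          exact absurd (hB ▸ hc) hx
        · simpa [List.filter_cons, hx] using h1 p B (by simpa using hB) hc
      · rintro (_ | p) (_ | q) B B' hB hc hB' hc' hlt
        · simp at hlt
        · simp at hB
          exact absurd (hB ▸ hc) hx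
        · simp at hlt
        · simpa using h2 p q B B' (by simpa using hB) hc (by simpa using hB') hc' (by omega)
      · intro a B hB
        simp only [List.filter_cons, hx] at hB
        obtain ⟨p, h4, h5, h6⟩ := h3 a B hB
        exact ⟨p + 1, by simpa using h4, h5, by simp [h6]⟩

/-- Each entry of the list is equal to an entry next to it. -/
def Mated {α : Type*} (A : List α) : Prop :=
  ∀ a < A.length, ∃ a', (a' + 1 = a ∨ a + 1 = a') ∧ A[a']? = A[a]?

theorem Mated.append {α : Type*} {A B : List α} (hA : Mated A) (hB : Mated B) :
    Mated (A ++ B) := by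
  intro a ha
  by_cases h : a < A.length
  · obtain ⟨a', h1, h2⟩ := hA a h
    have h3 : a' < A.length := by
      by_contra h3
      rw [List.getElem?_eq_none (by omega), List.getElem?_eq_getElem h] at h2
      cases h2
    exact ⟨a', h1, by rw [List.getElem?_append_left h3, List.getElem?_append_left h, h2]⟩
  · rw [List.length_append] at ha
    obtain ⟨a', h1, h2⟩ := hB (a - A.length) (by omega)
    refine ⟨a' + A.length, by omega, ?_⟩
    rw [List.getElem?_append_right (by omega), List.getElem?_append_right (by omega), ← h2]
    congr 1
    omega

theorem Mated.map {α β : Type*} {A : List α} (hA : Mated A) (f : α → β) : Mated (A.map f) := by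
  intro a ha
  obtain ⟨a', h1, h2⟩ := hA a (by simpa using ha)
  exact ⟨a', h1, by simp [h2]⟩

theorem mated_replicate {α : Type*} (n : ℕ) (x : α) : Mated (List.replicate (n + 2) x) := by
  intro a ha
  rw [List.length_replicate] at ha
  rcases a with _ | a
  · exact ⟨1, by simp⟩
  · exact ⟨a, by simp, by
      rw [List.getElem?_replicate, List.getElem?_replicate, if_pos (by omega), if_pos ha]⟩

theorem mated_flatMap_labels (Z : List (Zone V)) : Mated (Z.flatMap Zone.labels) := by
  induction Z with
  | nil => intro a ha; simp at ha
  | cons z Z ih =>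
    rw [List.flatMap_cons]
    refine Mated.append ?_ ih
    cases z
    · exact mated_replicate 2 _
    · exact mated_replicate 1 _

/-- The ancestor lists of the vertices with ancestors in the own zones of `u`. -/
def ownLabels (u : V) (B : List V) : List (List V) := (ownZones u B).flatMap Zone.labels

theorem mem_ownLabels {u : V} {B A : List V} (h : A ∈ ownLabels u B) :
    A = [u] ∨ (∃ v ∈ B, A = [u, v]) ∨ A = B := by
  rcases B with _ | ⟨v, _ | ⟨w, _ | ⟨x, B⟩⟩⟩
  · simp [ownLabels, ownZones, Zone.labels] at h
    exact .inl h
  · simp [ownLabels, ownZones, Zone.labels] at h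
    rcases h with h | h | h <;> simp [h]
  · simp [ownLabels, ownZones, Zone.labels] at h
    rcases h with h | h | h | h | h | h | h | h | h <;> simp [h]
  · simp [ownLabels, ownZones] at h

theorem mem_ownLabels_length {u : V} {B A : List V} (h : A ∈ ownLabels u B) :
    0 < A.length ∧ A.length ≤ 2 := by
  rcases B with _ | ⟨v, _ | ⟨w, _ | ⟨x, B⟩⟩⟩
  · simp [ownLabels, ownZones, Zone.labels] at h
    simp [h]
  · simp [ownLabels, ownZones, Zone.labels] at h
    rcases h with h | h | h <;> simp [h]
  · simp [ownLabels, ownZones, Zone.labels] at h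
    rcases h with h | h | h | h | h | h | h | h | h <;> simp [h]
  · simp [ownLabels, ownZones] at h

theorem ownLabels_first (u : V) {B : List V} (hB : B.length ≤ 2) :
    ∃ r, ownLabels u B = [u] :: r := by
  rcases B with _ | ⟨v, _ | ⟨w, _ | ⟨x, B⟩⟩⟩
  · exact ⟨_, rfl⟩
  · exact ⟨_, rfl⟩
  · exact ⟨_, rfl⟩
  · simp at hB

theorem ownLabels_last (u : V) {B : List V} (hB : B.length ≤ 2) :
    ∃ r, ownLabels u B = r ++ [[u]] := by
  -- Reversal brings the last entry to the head, where evaluation exposes it.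
  have : ∃ r, (ownLabels u B).reverse = [u] :: r := by
    rcases B with _ | ⟨v, _ | ⟨w, _ | ⟨x, B⟩⟩⟩
    · exact ⟨_, rfl⟩
    · exact ⟨_, rfl⟩
    · exact ⟨_, rfl⟩
    · simp at hB
  obtain ⟨r, hr⟩ := this
  exact ⟨r.reverse, by rw [← List.reverse_inj, hr]; simp⟩

/-- After the initial zone labelled by `u` alone comes a zone that sees every ancestor of `u`:
`O_{u,v}` for type 1, `E_{v,w}` for type 2. -/
theorem ownLabels_anc_first (u : V) {B : List V} (hB : B.length ≤ 2) (hne : B ≠ []) :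
    ∃ r A r', ownLabels u B = r ++ A :: r' ∧ B ⊆ A ∧ ∀ A' ∈ r, A' = [u] := by
  rcases B with _ | ⟨v, _ | ⟨w, _ | ⟨x, B⟩⟩⟩
  · exact absurd rfl hne
  · exact ⟨List.replicate 3 [u], [u, v], _, rfl, by simp, by simp⟩
  · exact ⟨List.replicate 4 [u], [v, w], _, rfl, by simp, by simp⟩
  · simp at hB

theorem ownLabels_anc_last (u : V) {B : List V} (hB : B.length ≤ 2) (hne : B ≠ []) :
    ∃ r A r', ownLabels u B = r ++ A :: r' ∧ B ⊆ A ∧ ∀ A' ∈ r', A' = [u] := by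
  have : ∃ r A r', (ownLabels u B).reverse = r ++ A :: r' ∧ B ⊆ A ∧ ∀ A' ∈ r, A' = [u] := by
    rcases B with _ | ⟨v, _ | ⟨w, _ | ⟨x, B⟩⟩⟩
    · exact absurd rfl hne
    · exact ⟨List.replicate 3 [u], [u, v], _, rfl, by simp, by simp⟩
    · exact ⟨List.replicate 4 [u], [v, w], _, rfl, by simp, by simp⟩
    · simp at hB
  obtain ⟨r, A, r', h1, h2, h3⟩ := this
  refine ⟨r'.reverse, A, r.reverse, ?_, h2, fun A' h => h3 A' (by simpa using h)⟩
  rw [← List.reverse_inj, h1]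
  simp

/-- The ancestor lists of the vertices with ancestors above a layer, from left to right, with their
heights; `k` is the index of the first vertex of the layer. -/
def annot (anc : V → List V) : ℕ → List V → List (ℕ × List V)
  | _, [] => []
  | k, [u] => (ownLabels u (anc u)).map fun A => (2 * k, A)
  | k, u :: u'' :: rest => ((ownLabels u (anc u)).map fun A => (2 * k, A)) ++
      (List.replicate 4 (2 * k + 1, [u, u'']) ++ annot anc (k + 1) (u'' :: rest))

theorem map_snd_annot (anc : V → List V) (k : ℕ) (L : List V) :
    (annot anc k L).map Prod.snd = (layerZones anc L).flatMap Zone.labels := by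
  induction L generalizing k with
  | nil => rfl
  | cons u L ih =>
    rcases L with _ | ⟨u'', L⟩
    · simp [annot, layerZones, ownLabels, Function.comp_def]
    · simp only [annot, layerZones, List.map_append, List.flatMap_append, ih (k + 1)]
      simp [ownLabels, Function.comp_def, Zone.labels]

theorem mated_annot (anc : V → List V) (k : ℕ) (L : List V) : Mated (annot anc k L) := by
  induction L generalizing k with
  | nil => intro a ha; simp [annot] at ha
  | cons u L ih =>
    rcases L with _ | ⟨u'', L⟩
    · exact (mated_flatMap_labels _).map _
    · exact ((mated_flatMap_labels _).map _).append ((mated_replicate 2 _).append (ih _))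

theorem mem_annot {anc : V → List V} {k : ℕ} {L : List V} {y : ℕ × List V}
    (h : y ∈ annot anc k L) :
    (∃ j u, L[j]? = some u ∧ y.1 = 2 * (k + j) ∧ y.2 ∈ ownLabels u (anc u)) ∨
      ∃ j u u'', L[j]? = some u ∧ L[j + 1]? = some u'' ∧ y.1 = 2 * (k + j) + 1 ∧
        y.2 = [u, u''] := by
  induction L generalizing k with
  | nil => simp [annot] at h
  | cons u L ih =>
    rcases L with _ | ⟨u'', L⟩
    · simp only [annot, List.mem_map] at h
      obtain ⟨A, hA, rfl⟩ := h
      exact .inl ⟨0, u, by simp, by simp, hA⟩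
    · simp only [annot, List.mem_append, List.mem_map] at h
      rcases h with ⟨A, hA, rfl⟩ | h | h
      · exact .inl ⟨0, u, by simp, by simp, hA⟩
      · obtain rfl := (List.mem_replicate.1 h).2
        exact .inr ⟨0, u, u'', by simp⟩
      · rcases ih h with ⟨j, v, h1, h2, h3⟩ | ⟨j, v, v', h1, h2, h3, h4⟩
        · exact .inl ⟨j + 1, v, by simpa using h1, by omega, h3⟩
        · exact .inr ⟨j + 1, v, v', by simpa using h1, by simpa using h2, by omega, h4⟩

theorem annot_split (anc : V → List V) (k : ℕ) (L : List V) (j : ℕ) (u : V)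
    (hj : L[j]? = some u) :
    ∃ pre post, annot anc k L =
        pre ++ ((ownLabels u (anc u)).map (fun A => (2 * (k + j), A)) ++ post) ∧
      (∀ y ∈ pre, y.1 < 2 * (k + j)) ∧ ∀ y ∈ post, 2 * (k + j) < y.1 := by
  induction L generalizing k j with
  | nil => simp at hj
  | cons v L ih =>
    rcases L with _ | ⟨u'', L⟩
    · rcases j with _ | j
      · simp at hj
        subst hj
        exact ⟨[], [], by simp [annot], by simp, by simp⟩
      · simp at hj
    · rcases j with _ | j
      · simp at hj
        subst hj
        refine ⟨[], List.replicate 4 (2 * k + 1, [v, u'']) ++ annot anc (k + 1) (u'' :: L),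
          by simp [annot], by simp, ?_⟩
        intro y hy
        rcases List.mem_append.1 hy with hy | hy
        · rw [(List.mem_replicate.1 hy).2]; simp
        · rcases mem_annot hy with ⟨j, _, _, h, _⟩ | ⟨j, _, _, _, _, h, _⟩ <;> omega
      · obtain ⟨pre, post, h1, h2, h3⟩ := ih (k + 1) j (by simpa using hj)
        have e : k + 1 + j = k + (j + 1) := by ring
        rw [e] at h1 h2 h3
        refine ⟨((ownLabels v (anc v)).map fun A => (2 * k, A)) ++
          (List.replicate 4 (2 * k + 1, [v, u'']) ++ pre), post, ?_, ?_, h3⟩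
        · simp [annot, h1]
        · intro y hy
          simp only [List.mem_append, List.mem_map] at hy
          rcases hy with ⟨A, -, rfl⟩ | hy | hy
          · simp
          · rw [(List.mem_replicate.1 hy).2]
            simp only
            omega
          · exact h2 y hy

theorem mem_annot_odd (anc : V → List V) (k : ℕ) (L : List V) (j : ℕ) (u u'' : V)
    (hj : L[j]? = some u) (hj' : L[j + 1]? = some u'') :
    (2 * (k + j) + 1, [u, u'']) ∈ annot anc k L := by
  induction L generalizing k j with
  | nil => simp at hj
  | cons v L ih =>
    rcases L with _ | ⟨w, L⟩
    · simp at hj'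
    · rcases j with _ | j
      · simp at hj hj'
        subst hj hj'
        simp [annot]
      · have := ih (k + 1) j (by simpa using hj) (by simpa using hj')
        rw [show k + 1 + j = k + (j + 1) by ring] at this
        simp only [annot, List.mem_append]
        exact .inr (.inr this)

theorem annot_sorted (anc : V → List V) (k : ℕ) (L : List V) :
    (annot anc k L).Pairwise fun y z => y.1 ≤ z.1 := by
  induction L generalizing k with
  | nil => simp [annot]
  | cons v L ih =>
    have hown : ((ownLabels v (anc v)).map fun A => (2 * k, A)).Pairwise fun y z => y.1 ≤ z.1 := by
      rw [List.pairwise_map]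
      exact List.pairwise_of_forall fun _ _ => le_rfl
    rcases L with _ | ⟨w, L⟩
    · exact hown
    · have hlow : ∀ y ∈ annot anc (k + 1) (w :: L), 2 * k + 2 ≤ y.1 := by
        intro y hy
        rcases mem_annot hy with ⟨j, _, _, h, _⟩ | ⟨j, _, _, _, _, h, _⟩ <;> omega
      simp only [annot]
      rw [List.pairwise_append, List.pairwise_append]
      refine ⟨hown, ⟨?_, ih _, ?_⟩, ?_⟩
      · rw [List.pairwise_replicate]; simp
      · intro y hy z hz
        rw [(List.mem_replicate.1 hy).2]
        have := hlow z hz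
        simp only
        omega
      · intro y hy z hz
        obtain ⟨A, -, rfl⟩ := List.mem_map.1 hy
        rcases List.mem_append.1 hz with hz | hz
        · rw [(List.mem_replicate.1 hz).2]; simp
        · have := hlow z hz
          simp only
          omega

/-- The entry of `N` at position `p` is the nonempty list `B`. -/
def EntryAt (N : List (List V)) (p : ℤ) (B : List V) : Prop :=
  0 ≤ p ∧ N[p.toNat]? = some B ∧ B ≠ []

/-- A list `A` of nonempty lists with heights, the lists being the nonempty entries of `N`, induces
heights of the positions of these entries. -/
theorem exists_height (N : List (List V)) (A : List (ℕ × List V))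
    (hA : N.filter (fun B => !B.isEmpty) = A.map Prod.snd) : ∃ h : ℤ → ℤ,
    (∀ p B, EntryAt N p B → ∃ y ∈ A, h p = y.1 ∧ B = y.2) ∧
    (∀ pre x post, A = pre ++ x :: post → ∃ p, EntryAt N p x.2 ∧ h p = x.1 ∧
      ∀ q B, EntryAt N q B → (q < p → ∃ y ∈ pre, h q = y.1 ∧ B = y.2) ∧
        (p < q → ∃ y ∈ post, h q = y.1 ∧ B = y.2)) ∧
    (A.Pairwise (fun y z => y.1 ≤ z.1) →
      ∀ p q B B', EntryAt N p B → EntryAt N q B' → p ≤ q → h p ≤ h q) ∧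
    (Mated A → ∀ p B, EntryAt N p B → ∃ q, EntryAt N q B ∧ q ≠ p ∧
      ∀ r B', EntryAt N r B' → ¬ (p < r ∧ r < q) ∧ ¬ (q < r ∧ r < p)) := by
  obtain ⟨g, h1, h2, h3⟩ := exists_filter_index (fun B => !B.isEmpty) N
  rw [hA] at h1 h3
  have hne : ∀ B : List V, ((!B.isEmpty) = true) ↔ B ≠ [] := by intro B; simp
  simp only [hne] at h1 h2 h3
  -- The height annotated at the filtered index of `p`; the default 0 matters only where there is no
  -- entry.
  let h : ℤ → ℤ := fun p => ((A[g p.toNat]?.map Prod.fst).getD 0 : ℕ)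
  have hent : ∀ p B, EntryAt N p B → ∃ n : ℕ, A[g p.toNat]? = some (n, B) ∧ h p = n := by
    rintro p B ⟨hp, hB, hBne⟩
    have := h1 _ B hB hBne
    rw [List.getElem?_map, Option.map_eq_some_iff] at this
    obtain ⟨⟨n, B'⟩, h4, rfl⟩ := this
    exact ⟨n, h4, by simp [h, h4]⟩
  have hlt : ∀ p q B B', EntryAt N p B → EntryAt N q B' → p < q → g p.toNat < g q.toNat := by
    rintro p q B B' ⟨hp, hB, hBne⟩ ⟨hq, hB', hBne'⟩ hpq
    exact h2 _ _ B B' hB hBne hB' hBne' (by omega)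
  have hsurj : ∀ (a n : ℕ) (B : List V), A[a]? = some (n, B) → ∃ p, EntryAt N p B ∧ g p.toNat = a ∧ h p = n := by
    intro a n B ha
    obtain ⟨p, h4, h5, h6⟩ := h3 a B (by simp [ha])
    refine ⟨p, ⟨by omega, by simpa using h4, h5⟩, by simpa using h6, ?_⟩
    simp [h, h6, ha]
  refine ⟨h, ?_, ?_, ?_, ?_⟩
  · intro p B hp
    obtain ⟨n, h4, h5⟩ := hent p B hp
    exact ⟨(n, B), List.mem_of_getElem? h4, h5, rfl⟩
  · rintro pre ⟨n, B⟩ post rfl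
    obtain ⟨p, hp1, hp2, hp3⟩ := hsurj pre.length n B (by simp)
    refine ⟨p, hp1, hp3, fun q B' hq => ?_⟩
    obtain ⟨n', h4, h5⟩ := hent q B' hq
    constructor
    · intro hqp
      have := hlt _ _ _ _ hq hp1 hqp
      rw [List.getElem?_append_left (by omega)] at h4
      exact ⟨(n', B'), List.mem_of_getElem? h4, h5, rfl⟩
    · intro hqp
      have := hlt _ _ _ _ hp1 hq hqp
      rw [List.getElem?_append_right (by omega)] at h4
      obtain ⟨d, hd⟩ : ∃ d, g q.toNat - pre.length = d + 1 :=
        ⟨g q.toNat - pre.length - 1, by omega⟩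
      rw [hd, List.getElem?_cons_succ] at h4
      exact ⟨(n', B'), List.mem_of_getElem? h4, h5, rfl⟩
  · intro hs p q B B' hp hq hpq
    obtain ⟨n, h4, h5⟩ := hent p B hp
    obtain ⟨n', h4', h5'⟩ := hent q B' hq
    rcases hpq.eq_or_lt with rfl | hpq
    · exact le_rfl
    · have hlt := hlt _ _ _ _ hp hq hpq
      rw [List.pairwise_iff_getElem] at hs
      obtain ⟨a1, a2⟩ := List.getElem?_eq_some_iff.1 h4
      obtain ⟨b1, b2⟩ := List.getElem?_eq_some_iff.1 h4'
      have := hs _ _ a1 b1 hlt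
      rw [a2, b2] at this
      simp only at this
      omega
  · intro hm p B hp
    obtain ⟨n, h4, h5⟩ := hent p B hp
    obtain ⟨a, ha1, ha2⟩ := hm _ (List.getElem?_eq_some_iff.1 h4).1
    obtain ⟨q, hq1, hq2, hq3⟩ := hsurj a n B (ha2.trans h4)
    refine ⟨q, hq1, ?_, fun r B' hr => ⟨fun hh => ?_, fun hh => ?_⟩⟩
    · rintro rfl; omega
    · have := hlt _ _ _ _ hp hr hh.1
      have := hlt _ _ _ _ hr hq1 hh.2
      omega
    · have := hlt _ _ _ _ hq1 hr hh.1
      have := hlt _ _ _ _ hr hp hh.2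
      omega

/-! ### Consecutive layers of a layered wheel form a ladder. -/

/-- The vertices of the layers `0, …, i`. -/
def lowSet (P : ℕ → List V) (i : ℕ) : Set V := {v | ∃ j ≤ i, v ∈ P j}

theorem mem_ancestors {P : ℕ → List V} {i : ℕ} {u x : V} :
    x ∈ ancestors G P i u ↔ (∃ j < i, x ∈ P j) ∧ G.Adj u x := by
  simp [ancestors]

namespace IsLayering

variable {l k : ℕ} {P : ℕ → List V} {i : ℕ}

theorem filter_eq (L : IsLayering l k G P) (hi : i < l) :
    ((P (i + 1)).map (ancestors G P (i + 1))).filter (fun A => !A.isEmpty) =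
      (annot (ancestors G P i) 0 (P i)).map Prod.snd := by
  rw [map_snd_annot, L.zones i hi]

theorem adj_iff (L : IsLayering l k G P) (hi : i ≤ l) {a b : ℕ} {x y : V}
    (ha : (P i)[a]? = some x) (hb : (P i)[b]? = some y) : G.Adj x y ↔ a + 1 = b ∨ b + 1 = a := by
  obtain ⟨ha', rfl⟩ := List.getElem?_eq_some_iff.1 ha
  obtain ⟨hb', rfl⟩ := List.getElem?_eq_some_iff.1 hb
  exact L.path i hi a b ha' hb'

/-- The ancestors of a vertex are pairwise adjacent, and there are at most two of them. -/
theorem ancestors_clique (L : IsLayering l k G P) (hi : i ≤ l) {u : V} (hu : u ∈ P i) :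
    (ancestors G P i u).length ≤ 2 ∧
      ∀ s ∈ ancestors G P i u, ∀ s' ∈ ancestors G P i u, s ≠ s' → G.Adj s s' := by
  induction i generalizing u with
  | zero => simp [ancestors]
  | succ i ih =>
    by_cases hne : ancestors G P (i + 1) u = []
    · simp [hne]
    -- A nonempty ancestor list is one of the prescribed labels: `[u]`, `u` with one of its
    -- ancestors, all ancestors of `u` (a clique by induction), or two consecutive vertices.
    have hmem : ancestors G P (i + 1) u ∈ (annot (ancestors G P i) 0 (P i)).map Prod.snd := by
      rw [← L.filter_eq (by omega), List.mem_filter]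
      exact ⟨List.mem_map_of_mem hu, by simpa using hne⟩
    obtain ⟨y, hy, he⟩ := List.mem_map.1 hmem
    rw [← he]
    rcases mem_annot hy with ⟨j, v, h1, -, h2⟩ | ⟨j, v, v', h1, h2, -, h3⟩
    · have hv := List.mem_of_getElem? h1
      refine ⟨(mem_ownLabels_length h2).2, ?_⟩
      rcases mem_ownLabels h2 with h3 | ⟨w, hw, h3⟩ | h3 <;> rw [h3]
      · simp
      · have := (mem_ancestors.1 hw).2
        simp [this, this.symm]
      · exact (ih (by omega) hv).2
    · have := (L.adj_iff (by omega) h1 h2).2 (.inl rfl)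
      rw [h3]
      simp [this, this.symm]

/-- Such vertices are at distance at least `k - 2`, which is at least 2. -/
theorem ancestors_spaced (L : IsLayering l k G P) (hk : 4 ≤ k) (hi : i ≤ l) {a : ℕ} {x y : V}
    (ha : (P i)[a]? = some x) (hb : (P i)[a + 1]? = some y) (hx : ancestors G P i x ≠ [])
    (hy : ancestors G P i y ≠ []) : False := by
  rcases i with _ | i
  · simp [ancestors] at hx
  · obtain ⟨ha', rfl⟩ := List.getElem?_eq_some_iff.1 ha
    obtain ⟨hb', rfl⟩ := List.getElem?_eq_some_iff.1 hb
    have := (L.lengths i (by omega) a (a + 1) (by omega) hb' hx hy (by intros; omega)).1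
    omega

/-- Two consecutive layers with given heights as a strip. -/
def strip (P : ℕ → List V) (i : ℕ) (r : V) (h : ℤ → ℤ) : Strip V where
  p0 := 0
  p1 := (P (i + 1)).length - 1
  j0 := 0
  j1 := (P i).length - 1
  t p := (P (i + 1)).getD p.toNat r
  u j := (P i).getD j.toNat r
  h := h

variable {r : V} {h : ℤ → ℤ}

theorem strip_J {j : ℤ} : (strip P i r h).J j ↔
    0 ≤ j ∧ (P i)[j.toNat]? = some ((strip P i r h).u j) := by
  simp only [Strip.J, strip, List.getD_eq_getElem?_getD]
  constructor
  · rintro ⟨h1, h2⟩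
    have : j.toNat < (P i).length := by omega
    simp [h1, List.getElem?_eq_getElem this]
  · rintro ⟨h1, h2⟩
    have := (List.getElem?_eq_some_iff.1 h2).1
    omega

theorem strip_I {p : ℤ} : (strip P i r h).I p ↔
    0 ≤ p ∧ (P (i + 1))[p.toNat]? = some ((strip P i r h).t p) := by
  simp only [Strip.I, strip, List.getD_eq_getElem?_getD]
  constructor
  · rintro ⟨h1, h2⟩
    have : p.toNat < (P (i + 1)).length := by omega
    simp [h1, List.getElem?_eq_getElem this]
  · rintro ⟨h1, h2⟩
    have := (List.getElem?_eq_some_iff.1 h2).1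
    omega

theorem strip_J_natCast {n : ℕ} {u : V} (hn : (P i)[n]? = some u) :
    (strip P i r h).J n ∧ (strip P i r h).u n = u := by
  have : (strip P i r h).u n = u := by simp [strip, hn]
  exact ⟨strip_J.2 ⟨by omega, by simp [this, hn]⟩, this⟩

theorem strip_lab {p : ℤ} : (strip P i r h).lab G (lowSet P i) p =
    {s | s ∈ ancestors G P (i + 1) ((strip P i r h).t p)} := by
  ext s
  simp [Strip.lab, lowSet, mem_ancestors]

theorem strip_anc (L : IsLayering l k G P) (hi : i ≤ l) {j : ℤ} :
    (strip P i r h).anc G (lowSet P i) j =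
      {s | s ∈ ancestors G P i ((strip P i r h).u j)} := by
  ext s
  simp only [Strip.anc, lowSet, mem_ancestors, Set.mem_ofPred_eq]
  constructor
  · rintro ⟨⟨m, hm, hs⟩, hadj, hne⟩
    refine ⟨⟨m, hm.lt_of_ne ?_, hs⟩, hadj⟩
    rintro rfl
    obtain ⟨n, hn⟩ := List.mem_iff_getElem?.1 hs
    have := strip_J_natCast (r := r) (h := h) hn
    exact hne n this.1 this.2.symm
  · rintro ⟨⟨m, hm, hs⟩, hadj⟩
    refine ⟨⟨m, hm.le, hs⟩, hadj, ?_⟩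
    rintro q hq rfl
    exact L.disjoint m (by omega) i hi (by omega) hs (List.mem_of_getElem? (strip_J.1 hq).2)

/-- The nonempty ancestor lists of the upper layer. -/
abbrev Entry (G : SimpleGraph V) (P : ℕ → List V) (i : ℕ) : ℤ → List V → Prop :=
  EntryAt ((P (i + 1)).map (ancestors G P (i + 1)))

theorem entry_spec {p : ℤ} {B : List V} (hp : Entry G P i p B) :
    (strip P i r h).Labelled G (lowSet P i) p ∧
      (strip P i r h).lab G (lowSet P i) p = {s | s ∈ B} := by
  obtain ⟨h1, h2, h3⟩ := hp
  rw [List.getElem?_map, Option.map_eq_some_iff] at h2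
  obtain ⟨x, h4, rfl⟩ := h2
  have ht : (strip P i r h).t p = x := by simp [strip, h4]
  have hl : (strip P i r h).lab G (lowSet P i) p = {s | s ∈ ancestors G P (i + 1) x} := by
    rw [strip_lab, ht]
  refine ⟨⟨strip_I.2 ⟨h1, by rw [ht, h4]⟩, ?_⟩, hl⟩
  rw [hl]
  exact List.exists_mem_of_ne_nil _ h3

theorem exists_entry {p : ℤ} (hp : (strip P i r h).Labelled G (lowSet P i) p) :
    ∃ B, Entry G P i p B ∧ (strip P i r h).lab G (lowSet P i) p = {s | s ∈ B} := by
  obtain ⟨h1, h2⟩ := strip_I.1 hp.1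
  refine ⟨_, ⟨h1, by rw [List.getElem?_map, h2]; rfl, ?_⟩, strip_lab⟩
  obtain ⟨s, hs⟩ := hp.2
  rw [strip_lab] at hs
  exact List.ne_nil_of_mem hs

theorem exists_isLadder (L : IsLayering l k G P) (hk : 4 ≤ k) (hi : i < l) :
    ∃ D : Strip V, D.IsLadder G (lowSet P i) ∧ ∀ x ∈ P (i + 1), ∃ p, D.I p ∧ x = D.t p := by
  -- Only a default value for list lookups outside the layer is needed.
  obtain ⟨r, -⟩ := L.root
  obtain ⟨h, hmem, hsplit, hmono, hmate⟩ := exists_height _ _ (L.filter_eq hi)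
  have hent : ∀ p, (strip P i r h).Labelled G (lowSet P i) p →
      ∃ y ∈ annot (ancestors G P i) 0 (P i), (h p = y.1) ∧ Entry G P i p y.2 ∧
        (strip P i r h).lab G (lowSet P i) p = {s | s ∈ y.2} := by
    intro p hp
    obtain ⟨B, hB, hl⟩ := exists_entry hp
    obtain ⟨y, hy, h1, rfl⟩ := hmem p B hB
    exact ⟨y, hy, h1, hB, hl⟩
  have hu : ∀ (j : ℤ) (n : ℕ) (u : V), j = n → (P i)[n]? = some u → (strip P i r h).u j = u := by
    rintro j n u rfl hn
    exact (strip_J_natCast hn).2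
  have hsp : ∀ (j : ℤ) (hj : (strip P i r h).J j), ∃ (n : ℕ) (u : V), j = n ∧
      (P i)[n]? = some u ∧ (strip P i r h).u j = u ∧ (ancestors G P i u).length ≤ 2 ∧
      (strip P i r h).anc G (lowSet P i) j = {s | s ∈ ancestors G P i u} := by
    intro j hj
    obtain ⟨h1, h2⟩ := strip_J.1 hj
    refine ⟨j.toNat, _, by omega, h2, rfl, ?_, L.strip_anc hi.le⟩
    exact (L.ancestors_clique hi.le (List.mem_of_getElem? h2)).1
  have hnd : ∀ m ≤ l, ∀ (a b : ℕ) (x : V), (P m)[a]? = some x → (P m)[b]? = some x → a = b := by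
    intro m hm a b x ha hb
    exact (List.getElem?_inj (List.getElem?_eq_some_iff.1 ha).1 (L.nodup m hm)).1
      (ha.trans hb.symm)
  refine ⟨strip P i r h, ⟨?_, ?_, ?_, ?_, ?_, ?_, ?_, ?_, ?_, ?_, ?_, ?_, ?_, ?_, ?_, ?_, ?_, ?_, ?_⟩,
    ?_⟩
  · rintro p hp ⟨j, hj, hj'⟩
    exact L.disjoint j (by omega) (i + 1) (by omega) (by omega) hj'
      (List.mem_of_getElem? (strip_I.1 hp).2)
  · exact fun j hj => ⟨i, le_rfl, List.mem_of_getElem? (strip_J.1 hj).2⟩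
  · intro p q hp hq
    obtain ⟨h1, h2⟩ := strip_I.1 hp
    obtain ⟨h3, h4⟩ := strip_I.1 hq
    rw [L.adj_iff (by omega) h2 h4]
    omega
  · intro p q hp hq
    obtain ⟨h1, h2⟩ := strip_J.1 hp
    obtain ⟨h3, h4⟩ := strip_J.1 hq
    rw [L.adj_iff (by omega) h2 h4]
    omega
  · intro p q hp hq he
    obtain ⟨h1, h2⟩ := strip_I.1 hp
    obtain ⟨h3, h4⟩ := strip_I.1 hq
    rw [← he] at h4
    have := hnd _ (by omega) _ _ _ h2 h4
    omega
  · intro p q hp hq he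
    obtain ⟨h1, h2⟩ := strip_J.1 hp
    obtain ⟨h3, h4⟩ := strip_J.1 hq
    rw [← he] at h4
    have := hnd _ (by omega) _ _ _ h2 h4
    omega
  · rintro p q hp hq rfl
    obtain ⟨h1, h2⟩ := strip_I.1 hp.1
    obtain ⟨h3, h4⟩ := strip_I.1 hq.1
    have a1 := hp.2
    have a2 := hq.2
    rw [strip_lab] at a1 a2
    rw [show (p + 1).toNat = p.toNat + 1 by omega] at h4
    exact L.ancestors_spaced hk (by omega) h2 h4 (List.ne_nil_of_mem a1.some_mem)
      (List.ne_nil_of_mem a2.some_mem)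
  · rintro p q hp hq a1 a2 rfl
    obtain ⟨h1, h2⟩ := strip_J.1 hp
    obtain ⟨h3, h4⟩ := strip_J.1 hq
    rw [L.strip_anc hi.le] at a1 a2
    rw [show (p + 1).toNat = p.toNat + 1 by omega] at h4
    exact L.ancestors_spaced hk (by omega) h2 h4 (List.ne_nil_of_mem a1.some_mem)
      (List.ne_nil_of_mem a2.some_mem)
  · intro p q hp hq hpq
    obtain ⟨B, hB, -⟩ := exists_entry hp
    obtain ⟨B', hB', -⟩ := exists_entry hq
    exact hmono (annot_sorted _ _ _) p q B B' hB hB' hpq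
  · intro p hp
    obtain ⟨y, hy, h1, -, -⟩ := hent p hp
    simp only [strip, h1]
    rcases mem_annot hy with ⟨j, v, h2, h3, -⟩ | ⟨j, v, v', -, h2, h3, -⟩
    · have := (List.getElem?_eq_some_iff.1 h2).1
      omega
    · have := (List.getElem?_eq_some_iff.1 h2).1
      omega
  · intro p j hp hj s
    obtain ⟨y, hy, h1, -, hl⟩ := hent p hp
    have hj : h p = 2 * j + 1 := hj
    rw [hl, Set.mem_ofPred_eq]
    rcases mem_annot hy with ⟨n, v, h2, h3, -⟩ | ⟨n, v, v', h2, h3, h4, h5⟩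
    · omega
    · rw [h5, hu j n v (by omega) h2, hu (j + 1) (n + 1) v' (by omega) h3]
      simp
  · intro p j hp hj s
    obtain ⟨y, hy, h1, -, hl⟩ := hent p hp
    have hj : h p = 2 * j := hj
    rw [hl, Set.mem_ofPred_eq, L.strip_anc hi.le]
    rcases mem_annot hy with ⟨n, v, h2, h3, h4⟩ | ⟨n, v, v', h2, h3, h4, h5⟩
    · rw [hu j n v (by omega) h2]
      rcases mem_ownLabels h4 with h5 | ⟨w, hw, h5⟩ | h5 <;> rw [h5]
      · intro hs; exact .inl (by simpa using hs)
      · intro hs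
        rcases List.mem_cons.1 hs with rfl | hs
        · exact .inl rfl
        · rw [List.mem_singleton] at hs
          exact .inr (hs ▸ hw)
      · exact fun hs => .inr hs
    · omega
  · intro j hj
    obtain ⟨n, u, rfl, h1, h2, h3, -⟩ := hsp j hj
    obtain ⟨pre, post, h4, h5, -⟩ := annot_split (ancestors G P i) 0 (P i) n u h1
    obtain ⟨o, h6⟩ := ownLabels_first u h3
    rw [h6] at h4
    -- Splitting the annotated list at the first own label: everything before it has smaller height,
    -- which makes `p` the first position of its height. The axioms below use other splitting points
    -- in the same way.
    obtain ⟨p, hp1, hp2, hp3⟩ := hsplit pre (2 * (0 + n), [u]) _ (by rw [h4]; rfl)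
    refine ⟨p, (entry_spec hp1).1, ?_, ?_, fun q hq hqh => ?_⟩
    · simp [strip, hp2]
    · rw [(entry_spec hp1).2, h2]; ext s; simp
    · by_contra hlt
      obtain ⟨B, hB, -⟩ := exists_entry hq
      obtain ⟨y, hy, h7, -⟩ := (hp3 q B hB).1 (by omega)
      have := h5 y hy
      have hqh : h q = 2 * n := hqh
      omega
  · intro j hj
    obtain ⟨n, u, rfl, h1, h2, h3, -⟩ := hsp j hj
    obtain ⟨pre, post, h4, -, h5⟩ := annot_split (ancestors G P i) 0 (P i) n u h1
    obtain ⟨o, h6⟩ := ownLabels_last u h3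
    rw [h6, List.map_append, List.append_assoc, ← List.append_assoc] at h4
    obtain ⟨p, hp1, hp2, hp3⟩ := hsplit _ (2 * (0 + n), [u]) post h4
    refine ⟨p, (entry_spec hp1).1, ?_, ?_, fun q hq hqh => ?_⟩
    · simp [strip, hp2]
    · rw [(entry_spec hp1).2, h2]; ext s; simp
    · by_contra hlt
      obtain ⟨B, hB, -⟩ := exists_entry hq
      obtain ⟨y, hy, h7, -⟩ := (hp3 q B hB).2 (by omega)
      have := h5 y hy
      have hqh : h q = 2 * n := hqh
      omega
  · intro j hj hj'
    obtain ⟨n, u, rfl, h1, -⟩ := hsp j hj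
    obtain ⟨n', u', hn, h1', -⟩ := hsp _ hj'
    obtain rfl : n' = n + 1 := by omega
    obtain ⟨pre, post, he⟩ := List.append_of_mem (mem_annot_odd (ancestors G P i) 0 _ n u u' h1 h1')
    obtain ⟨p, hp1, hp2, -⟩ := hsplit _ _ _ he
    exact ⟨p, (entry_spec hp1).1, by simp [strip, hp2]⟩
  · intro j hj hne
    obtain ⟨n, u, rfl, h1, h2, h3, h4⟩ := hsp j hj
    rw [h4] at hne ⊢
    obtain ⟨pre, post, h5, h6, -⟩ := annot_split (ancestors G P i) 0 (P i) n u h1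
    obtain ⟨o, A, o', h7, h8, h9⟩ := ownLabels_anc_first u h3 (List.ne_nil_of_mem hne.some_mem)
    rw [h7, List.map_append, List.append_assoc, ← List.append_assoc] at h5
    obtain ⟨p, hp1, hp2, hp3⟩ := hsplit _ (2 * (0 + n), A) _ h5
    refine ⟨p, (entry_spec hp1).1, ?_, ?_, fun q hq hqh hqp s hs => ?_⟩
    · simp [strip, hp2]
    · rw [(entry_spec hp1).2]; exact fun s hs => h8 hs
    · obtain ⟨B, hB, hl⟩ := exists_entry hq
      obtain ⟨y, hy, h10, rfl⟩ := (hp3 q B hB).1 hqp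
      have hqh : h q = 2 * n := hqh
      rw [hl, Set.mem_ofPred_eq] at hs
      rcases List.mem_append.1 hy with hy | hy
      · have := h6 y hy; omega
      · obtain ⟨A', hA', rfl⟩ := List.mem_map.1 hy
        simp only [h9 A' hA', List.mem_singleton] at hs
        rw [hs, h2]
  · intro j hj hne
    obtain ⟨n, u, rfl, h1, h2, h3, h4⟩ := hsp j hj
    rw [h4] at hne ⊢
    obtain ⟨pre, post, h5, -, h6⟩ := annot_split (ancestors G P i) 0 (P i) n u h1
    obtain ⟨o, A, o', h7, h8, h9⟩ := ownLabels_anc_last u h3 (List.ne_nil_of_mem hne.some_mem)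
    rw [h7, List.map_append, List.append_assoc, ← List.append_assoc] at h5
    obtain ⟨p, hp1, hp2, hp3⟩ := hsplit _ (2 * (0 + n), A) _ h5
    refine ⟨p, (entry_spec hp1).1, ?_, ?_, fun q hq hqh hqp s hs => ?_⟩
    · simp [strip, hp2]
    · rw [(entry_spec hp1).2]; exact fun s hs => h8 hs
    · obtain ⟨B, hB, hl⟩ := exists_entry hq
      obtain ⟨y, hy, h10, rfl⟩ := (hp3 q B hB).2 hqp
      have hqh : h q = 2 * n := hqh
      rw [hl, Set.mem_ofPred_eq] at hs
      rcases List.mem_append.1 hy with hy | hy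
      · obtain ⟨A', hA', rfl⟩ := List.mem_map.1 hy
        simp only [h9 A' hA', List.mem_singleton] at hs
        rw [hs, h2]
      · have := h6 y hy; omega
  · intro p hp
    obtain ⟨B, hB, hl⟩ := exists_entry hp
    obtain ⟨q, hq1, hq2, hq3⟩ := hmate (mated_annot _ _ _) p B hB
    refine ⟨q, (entry_spec hq1).1, hq2, by rw [hl, (entry_spec hq1).2], fun r' hr => ?_⟩
    obtain ⟨B', hB', -⟩ := exists_entry hr
    exact hq3 r' B' hB'
  · intro j hj
    rw [L.strip_anc hi.le]
    exact (L.ancestors_clique hi.le (List.mem_of_getElem? (strip_J.1 hj).2)).2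
  · intro x hx
    obtain ⟨n, hn⟩ := List.mem_iff_getElem?.1 hx
    have : (strip P i r h).t n = x := by simp [strip, hn]
    exact ⟨n, strip_I.2 ⟨by omega, by simp [this, hn]⟩, this.symm⟩

end IsLayering

/-! ### The induction on the layers. -/

theorem finite_lowSet (P : ℕ → List V) (i : ℕ) : (lowSet P i).Finite := by
  have : lowSet P i = ⋃ j ∈ Set.Iic i, {v | v ∈ P j} := by
    ext v; simp [lowSet]
  rw [this]
  exact (Set.finite_Iic i).biUnion fun j _ => List.finite_toSet (P j)

/-- Each induction step lowers the configuration by one layer; in layer 0 the three triangle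
vertices would coincide. -/
theorem IsLayering.not_attached {l k : ℕ} {P : ℕ → List V} (L : IsLayering l k G P) (hk : 4 ≤ k)
    (i : ℕ) (hi : i ≤ l) (b : Fin 3 → V) (C : Set V) (h : Attached G b C)
    (hb : ∀ j, b j ∈ lowSet P i) : ¬ C ⊆ lowSet P i := by
  induction i generalizing b C with
  | zero =>
    obtain ⟨r, hr⟩ := L.root
    have : ∀ j, b j = r := by
      intro j
      obtain ⟨m, hm, hj⟩ := hb j
      obtain rfl : m = 0 := by omega
      simpa [hr] using hj
    exact absurd ((this 0).trans (this 1).symm) (h.tri 0 1 (by decide)).ne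
  | succ i ih =>
    intro hC
    obtain ⟨D, hD, hcov⟩ := L.exists_isLadder hk (i := i) (by omega)
    obtain ⟨b', C', h1, h2, h3⟩ := exists_attached_low hD h ((finite_lowSet P _).subset hC) (by
      intro x hx
      have : x ∈ lowSet P (i + 1) := by
        rcases hx with hx | ⟨j, rfl⟩
        · exact hC hx
        · exact hb j
      obtain ⟨m, hm, hxm⟩ := this
      rcases hm.eq_or_lt with rfl | hm
      · exact .inr (hcov x hxm)
      · exact .inl ⟨m, by omega, hxm⟩)
    exact ih (by omega) b' C' h1 h2 h3

end EHFWheel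

theorem mainTheorem3 {V : Type*} (G : SimpleGraph V) (l k : ℕ) (hl : 1 ≤ l) (hk : 4 ≤ k)
    (hG : EHFWheel.IsLayeredWheel l k G) : EHFWheel.PyramidFree G := by
  intro h
  obtain ⟨P, L⟩ := hG
  obtain ⟨b, C, hatt⟩ := h.exists_attached
  exact L.not_attached hk l le_rfl b C hatt (fun j => L.cover (b j)) fun x _ => L.cover x
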